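/- **Setting.** Let $0\le m\le n$ be integers. Let $C_{n,2\pi}$ be the space of all continuous maps $u:[0,1]\times\mathbb R\to\mathbb R^n$ that are $2\pi$-periodic in $t$, with norm $\|u\|_\infty=\max_{j}\max_{x}\max_{t}|u_j(x,t)|$, and let $C^1_{n,2\pi}$ be the space of all $u\in C_{n,2\pi}$ with $\partial_xu,\partial_tu\in C_{n,2\pi}$, with norm $\|u\|_\infty+\|\partial_xu\|_\infty+\|\partial_tu\|_\infty$. Let $C_{n,2\pi}(\mathbb R)$ be the space of continuous $2\pi$-periodic maps $v:\mathbb R\to\mathbb R^n$ with the sup norm, and $C^1_{n,2\pi}(\mathbb R)$ the space of all $v\in C_{n,2\pi}(\mathbb R)$ with $v'\in C_{n,2\pi}(\mathbb R)$, with norm $\|v\|_\infty+\|v'\|_\infty$. Write $C^1_{2\pi}=C^1_{1,2\pi}$. Consider the problem $$\partial_tu_j+a_j(x,t)\,\partial_xu_j+\sum_{k=1}^n b_{jk}(x,t)\,u_k=f_j(x,t),\qquad u_j(x,t)=u_j(x,t+2\pi),\qquad j\le n,$$ $$u_j(0,t)=(Ru)_j(t)\ \ (1\le j\le m),\qquad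 u_j(1,t)=(Ru)_j(t)\ \ (m<j\le n).$$ **Assumptions.** $a_j,b_{jk}\in C^1_{2\pi}$ for all $j,k\le n$; $a_j(x,t)\ne0$ for all $j$ and all $(x,t)\in[0,1]\times\mathbb R$; for all $j\ne k$ there is $\tilde b_{jk}\in C^1_{2\pi}$ with $b_{jk}=\tilde b_{jk}(a_k-a_j)$; $R:C_{n,2\pi}\to C_{n,2\pi}(\mathbb R)$ is a bounded linear operator whose restriction to $C^1_{n,2\pi}$ is a bounded linear operator from $C^1_{n,2\pi}$ to $C^1_{n,2\pi}(\mathbb R)$. **Notation.** For $j\le n$, $x\in[0,1]$, $t\in\mathbb R$ let $\xi\in[0,1]\mapsto\omega_j(\xi,x,t)$ be the solution of $\partial_\xi\omega_j=1/a_j(\xi,\omega_j)$, $\omega_j(x,x,t)=t$. Write $\omega_j(\xi)=\omega_j(\xi,x,t)$ and put $$c_j(\xi,x,t)=\exp\int_x^\xi\Big(\frac{b_{jj}}{a_j}\Big)(\eta,\omega_j(\eta))\,d\eta,\qquad d_j(\xi,x,t)=\frac{c_j(\xi,x,t)}{a_j(\xi,\omega_j(\xi))},$$ and $x_j=0$ for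 $j\le m$, $x_j=1$ for $m<j\le n$. For $f\in C_{n,2\pi}$, a *continuous solution* is a function $u\in C_{n,2\pi}$ such that for all $j\le n$, $x\in[0,1]$, $t\in\mathbb R$ $$u_j(x,t)=c_j(x_j,x,t)(Ru)_j(\omega_j(x_j))-\int_{x_j}^x d_j(\xi,x,t)\sum_{k\ne j}b_{jk}(\xi,\omega_j(\xi))u_k(\xi,\omega_j(\xi))\,d\xi+\int_{x_j}^x d_j(\xi,x,t)f_j(\xi,\omega_j(\xi))\,d\xi .$$ Let $C$ be the bounded linear operator on $C_{n,2\pi}$ given by $(Cv)_j(x,t)=c_j(x_j,x,t)\,(Rv)_j(\omega_j(x_j))$, and let $\mathcal K$ be the vector space of all continuous solutions for $f=0$. **Theorem.** Under these assumptions, suppose that there is $\ell\in\mathbb N$ with $\|C^\ell\|_{\mathcal L(C_{n,2\pi})}<1$. Then: (i) $\dim\mathcal K<\infty$, and the vector space of all $f\in C_{n,2\pi}$ for which there exists a continuous solution is a closed subspace of codimension $\dim\mathcal K$ in $C_{n,2\pi}$. (ii) If $\dim\mathcal K=0$, then for every $f\in C_{n,2\pi}$ there exists a unique continuous solution $u$.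 -/

import Mathlib

noncomputable section

namespace Hyperbolic

/-- The circle `ℝ / 2πℤ`. A `2π`-periodic continuous function of `t` is the same thing as a
continuous function on this circle. -/
abbrev Circ : Type := AddCircle (2 * Real.pi)

instance instFactTwoPi : Fact (0 < 2 * Real.pi) := ⟨Real.two_pi_pos⟩

/-- The strip `[0,1] × ℝ` modulo `2π`-translations in `t`. -/
abbrev Strip : Type := unitInterval × Circ

/-- `C_{n,2π}`: continuous maps `[0,1] × ℝ → ℝⁿ` which are `2π`-periodic in `t`, with the norm
`max_j max_x max_t |u_j|` (`ℝⁿ = Fin n → ℝ` carries the sup norm). -/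
abbrev CPer (n : ℕ) : Type := C(Strip, Fin n → ℝ)

/-- `C_{n,2π}(ℝ)`: continuous `2π`-periodic maps `ℝ → ℝⁿ`, with the sup norm. -/
abbrev CPerTime (n : ℕ) : Type := C(Circ, Fin n → ℝ)

/-- The value of `u` at the point `(x, t)`, for real `x ∈ [0,1]` and real `t`
(for `x` outside `[0,1]` the value at the nearest endpoint). -/
def ev {E : Type*} [TopologicalSpace E] (u : C(Strip, E)) (x t : ℝ) : E :=
  u (Set.projIcc 0 1 zero_le_one x, (t : Circ))

/-- `ux` and `ut` are the partial derivatives of `u` in `x` (one-sided at `x = 0` and `x = 1`)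
and in `t`; being elements of `C(Strip, E)`, they are continuous and periodic. -/
def HasPartials {E : Type*} [NormedAddCommGroup E] [NormedSpace ℝ E]
    (u ux ut : C(Strip, E)) : Prop :=
  ∀ (x : unitInterval) (t : ℝ),
    HasDerivWithinAt (fun y : ℝ => ev u y t) (ev ux x t) (Set.Icc 0 1) (x : ℝ) ∧
    HasDerivAt (fun s : ℝ => ev u x s) (ev ut x t) t

/-- `u` belongs to the class `C¹` of functions on `[0,1] × ℝ` that are `2π`-periodic in `t`. -/
def IsC1 {E : Type*} [NormedAddCommGroup E] [NormedSpace ℝ E] (u : C(Strip, E)) : Prop :=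
  ∃ ux ut : C(Strip, E), HasPartials u ux ut

/-- `v'` is the derivative of the periodic function `v`. -/
def HasTimeDeriv {E : Type*} [NormedAddCommGroup E] [NormedSpace ℝ E]
    (v v' : C(Circ, E)) : Prop :=
  ∀ t : ℝ, HasDerivAt (fun s : ℝ => v (s : Circ)) (v' (t : Circ)) t

/-- `R` maps `C¹_{n,2π}` into `C¹_{n,2π}(ℝ)` and is bounded for the norms
`‖u‖ + ‖∂ₓu‖ + ‖∂ₜu‖` and `‖v‖ + ‖v'‖`. -/
def IsC1Bounded {n : ℕ} (R : CPer n →L[ℝ] CPerTime n) : Prop :=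
  ∃ M : ℝ, ∀ u ux ut : CPer n, HasPartials u ux ut →
    ∃ w : CPerTime n, HasTimeDeriv (R u) w ∧ ‖R u‖ + ‖w‖ ≤ M * (‖u‖ + ‖ux‖ + ‖ut‖)

/-- `ω` solves, on `[0,1]`, the initial value problem `ω'(ξ) = 1 / a(ξ, ω(ξ))`, `ω(x) = t`. -/
def IsCharacteristic (a : C(Strip, ℝ)) (x : unitInterval) (t : ℝ) (ω : ℝ → ℝ) : Prop :=
  ω x = t ∧ ∀ ξ ∈ Set.Icc (0 : ℝ) 1,
    HasDerivWithinAt ω (1 / ev a ξ (ω ξ)) (Set.Icc 0 1) ξ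

/-- The characteristic `ξ ↦ ω(ξ, x, t)` through `(x, t)`. By `characteristic_spec` and
`IsCharacteristic.unique` below, for a nowhere vanishing speed `a` of class `C¹` it is the solution
on `[0,1]` of the initial value problem. -/
def characteristic (a : C(Strip, ℝ)) (x : unitInterval) (t : ℝ) : ℝ → ℝ :=
  Classical.epsilon (IsCharacteristic a x t)

variable {n : ℕ}

/-- `ω_j(ξ, x, t)`. -/
def omega (a : Fin n → C(Strip, ℝ)) (j : Fin n) (ξ : ℝ) (x : unitInterval) (t : ℝ) : ℝ :=
  characteristic (a j) x t ξ

/-- `c_j(ξ, x, t) = exp ∫_x^ξ (b_jj / a_j)(η, ω_j(η)) dη`. -/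
def cCoef (a : Fin n → C(Strip, ℝ)) (b : Fin n → Fin n → C(Strip, ℝ)) (j : Fin n)
    (ξ : ℝ) (x : unitInterval) (t : ℝ) : ℝ :=
  Real.exp (∫ η in (x : ℝ)..ξ, ev (b j j) η (omega a j η x t) / ev (a j) η (omega a j η x t))

/-- `d_j(ξ, x, t) = c_j(ξ, x, t) / a_j(ξ, ω_j(ξ))`. -/
def dCoef (a : Fin n → C(Strip, ℝ)) (b : Fin n → Fin n → C(Strip, ℝ)) (j : Fin n)
    (ξ : ℝ) (x : unitInterval) (t : ℝ) : ℝ :=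
  cCoef a b j ξ x t / ev (a j) ξ (omega a j ξ x t)

/-- The point where the boundary condition for `u_j` is posed: `0` for the first `m` components,
`1` for the others. -/
def bdPoint (m : ℕ) (j : Fin n) : unitInterval := if (j : ℕ) < m then 0 else 1

/-- `u` is a continuous solution of the boundary value problem with right-hand side `f`: it
satisfies the system integrated along characteristics. -/
def IsContinuousSolution (m : ℕ) (a : Fin n → C(Strip, ℝ)) (b : Fin n → Fin n → C(Strip, ℝ))
    (R : CPer n →L[ℝ] CPerTime n) (f u : CPer n) : Prop :=
  ∀ (j : Fin n) (x : unitInterval) (t : ℝ),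
    ev u x t j =
      cCoef a b j (bdPoint m j) x t * R u (omega a j (bdPoint m j) x t : Circ) j
      - (∫ ξ in (bdPoint m j : ℝ)..x, dCoef a b j ξ x t *
          ∑ k ∈ Finset.univ.filter (fun k => k ≠ j),
            ev (b j k) ξ (omega a j ξ x t) * ev u ξ (omega a j ξ x t) k)
      + ∫ ξ in (bdPoint m j : ℝ)..x, dCoef a b j ξ x t * ev f ξ (omega a j ξ x t) j

/-! Well-posedness of the characteristics -/

theorem continuous_ev {E : Type*} [TopologicalSpace E] (u : C(Strip, E)) :
    Continuous (fun p : ℝ × ℝ => ev u p.1 p.2) := by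
  unfold ev
  refine u.continuous.comp (Continuous.prodMk ?_ ?_)
  · exact continuous_projIcc.comp continuous_fst
  · exact (AddCircle.continuous_mk' _).comp continuous_snd

theorem ev_coe {E : Type*} [TopologicalSpace E] (u : C(Strip, E)) (x : unitInterval) (t : ℝ) :
    ev u x t = u (x, (t : Circ)) := by
  simp [ev]

theorem ev_add_period {E : Type*} [TopologicalSpace E] (u : C(Strip, E)) (x t : ℝ) :
    ev u x (t + 2 * Real.pi) = ev u x t := by
  unfold ev
  rw [AddCircle.coe_add_period]

theorem exists_bound {a : C(Strip, ℝ)} (ha0 : ∀ p, a p ≠ 0) :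
    ∃ M : NNReal, ∀ ξ s : ℝ, ‖1 / ev a ξ s‖ ≤ M := by
  let q : C(Strip, ℝ) := ⟨fun p => 1 / a p, continuous_const.div a.continuous ha0⟩
  exact ⟨‖q‖₊, fun ξ s => q.norm_coe_le_norm (Set.projIcc 0 1 zero_le_one ξ, (s : Circ))⟩

theorem exists_lipschitz {a : C(Strip, ℝ)} (ha : IsC1 a) (ha0 : ∀ p, a p ≠ 0) :
    ∃ K : NNReal, ∀ ξ : ℝ, LipschitzWith K (fun s => 1 / ev a ξ s) := by
  obtain ⟨ax, at', h⟩ := ha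
  let q : C(Strip, ℝ) := ⟨fun p => -at' p / a p ^ 2,
    at'.continuous.neg.div (a.continuous.pow 2) (fun p => pow_ne_zero 2 (ha0 p))⟩
  refine ⟨‖q‖₊, fun ξ => ?_⟩
  have hd : ∀ s : ℝ, HasDerivAt (fun s => 1 / ev a ξ s)
      (q (Set.projIcc 0 1 zero_le_one ξ, (s : Circ))) s := by
    intro s
    have h1 := (h (Set.projIcc 0 1 zero_le_one ξ) s).2
    simp only [ev_coe] at h1
    have h2 := h1.inv (ha0 _)
    simpa [ev, q, one_div] using! h2
  refine lipschitzWith_of_nnnorm_deriv_le (fun s => (hd s).differentiableAt) (fun s => ?_)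
  rw [(hd s).deriv]
  exact q.norm_coe_le_norm _

theorem exists_isCharacteristic {a : C(Strip, ℝ)} (ha : IsC1 a) (ha0 : ∀ p, a p ≠ 0)
    (x : unitInterval) (t : ℝ) : ∃ ω, IsCharacteristic a x t ω := by
  obtain ⟨M, hM⟩ := exists_bound ha0
  obtain ⟨K, hK⟩ := exists_lipschitz ha ha0
  have hc : Continuous (fun p : ℝ × ℝ => 1 / ev a p.1 p.2) :=
    continuous_const.div (continuous_ev a) (fun p => ha0 _)
  have hp : IsPicardLindelof (fun ξ s => 1 / ev a ξ s) (tmin := 0) (tmax := 1) x t M 0 M K :=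
    { lipschitzOnWith := fun ξ _ => (hK ξ).lipschitzOnWith
      continuousOn := fun s _ =>
        (hc.comp (continuous_id.prodMk continuous_const)).continuousOn
      norm_le := fun ξ _ s _ => hM ξ s
      mul_max_le := by
        have h1 : max (1 - (x : ℝ)) (x - 0) ≤ 1 :=
          max_le (by linarith [x.2.1]) (by linarith [x.2.2])
        simpa using mul_le_mul_of_nonneg_left h1 M.2 }
  obtain ⟨ω, h1, h2⟩ := hp.exists_eq_forall_mem_Icc_hasDerivWithinAt₀
  exact ⟨ω, h1, h2⟩

theorem characteristic_spec {a : C(Strip, ℝ)} (ha : IsC1 a) (ha0 : ∀ p, a p ≠ 0)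
    (x : unitInterval) (t : ℝ) : IsCharacteristic a x t (characteristic a x t) :=
  Classical.epsilon_spec (exists_isCharacteristic ha ha0 x t)

theorem dist_le_forward {v : ℝ → ℝ → ℝ} {K : NNReal} (hK : ∀ ξ, LipschitzWith K (v ξ))
    {p q : ℝ} {f g : ℝ → ℝ}
    (hf : ∀ ξ ∈ Set.Icc p q, HasDerivWithinAt f (v ξ (f ξ)) (Set.Icc p q) ξ)
    (hg : ∀ ξ ∈ Set.Icc p q, HasDerivWithinAt g (v ξ (g ξ)) (Set.Icc p q) ξ)
    {s r : ℝ} (hs : s ∈ Set.Icc p q) (hr : r ∈ Set.Icc s q) :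
    |f r - g r| ≤ |f s - g s| * Real.exp (K * (q - p)) := by
  have key : ∀ {h : ℝ → ℝ},
      (∀ ξ ∈ Set.Icc p q, HasDerivWithinAt h (v ξ (h ξ)) (Set.Icc p q) ξ) →
      ContinuousOn h (Set.Icc s q) ∧
        ∀ ξ ∈ Set.Ico s q, HasDerivWithinAt h (v ξ (h ξ)) (Set.Ici ξ) ξ := by
    intro h hh
    refine ⟨fun ξ hξ => ((hh ξ ⟨hs.1.trans hξ.1, hξ.2⟩).continuousWithinAt).mono
      (Set.Icc_subset_Icc_left hs.1), fun ξ hξ => ?_⟩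
    refine (hh ξ ⟨hs.1.trans hξ.1, hξ.2.le⟩).mono_of_mem_nhdsWithin ?_
    exact Filter.mem_of_superset (Icc_mem_nhdsGE hξ.2)
      (Set.Icc_subset_Icc_left (hs.1.trans hξ.1))
  have h1 := dist_le_of_trajectories_ODE hK (key hf).1 (key hf).2 (key hg).1 (key hg).2
    (le_refl (dist (f s) (g s))) r hr
  rw [Real.dist_eq, Real.dist_eq] at h1
  refine h1.trans (mul_le_mul_of_nonneg_left ?_ (abs_nonneg _))
  refine Real.exp_le_exp.mpr (mul_le_mul_of_nonneg_left ?_ K.2)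
  linarith [hr.2, hs.1]

theorem dist_le_both {v : ℝ → ℝ → ℝ} {K : NNReal} (hK : ∀ ξ, LipschitzWith K (v ξ))
    {f g : ℝ → ℝ}
    (hf : ∀ ξ ∈ Set.Icc (0 : ℝ) 1, HasDerivWithinAt f (v ξ (f ξ)) (Set.Icc 0 1) ξ)
    (hg : ∀ ξ ∈ Set.Icc (0 : ℝ) 1, HasDerivWithinAt g (v ξ (g ξ)) (Set.Icc 0 1) ξ)
    {s r : ℝ} (hs : s ∈ Set.Icc (0 : ℝ) 1) (hr : r ∈ Set.Icc (0 : ℝ) 1) :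
    |f r - g r| ≤ |f s - g s| * Real.exp K := by
  rcases le_total s r with h | h
  · simpa using dist_le_forward hK hf hg hs ⟨h, hr.2⟩
  · have hrev : ∀ {k : ℝ → ℝ},
        (∀ ξ ∈ Set.Icc (0 : ℝ) 1, HasDerivWithinAt k (v ξ (k ξ)) (Set.Icc 0 1) ξ) →
        ∀ ξ ∈ Set.Icc (-1 : ℝ) 0,
          HasDerivWithinAt (fun τ => k (-τ)) (-(v (-ξ) (k (-ξ)))) (Set.Icc (-1) 0) ξ := by
      intro k hk ξ hξ
      have h1 := hk (-ξ) ⟨by linarith [hξ.2], by linarith [hξ.1]⟩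
      have h2 : HasDerivWithinAt (fun τ : ℝ => -τ) (-1) (Set.Icc (-1) 0) ξ :=
        (hasDerivAt_neg ξ).hasDerivWithinAt
      have h3 := h1.scomp ξ h2
        (fun τ hτ => ⟨by linarith [hτ.2], by linarith [hτ.1]⟩)
      simpa [Function.comp_def] using! h3
    have hK' : ∀ ξ, LipschitzWith K (fun y => -(v (-ξ) y)) := fun ξ => (hK (-ξ)).neg
    have h4 := dist_le_forward (v := fun ξ y => -(v (-ξ) y)) hK' (hrev hf) (hrev hg)
      (s := -s) (r := -r) ⟨by linarith [hs.2], by linarith [hs.1]⟩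
      ⟨by linarith, by linarith [hr.1]⟩
    simpa using h4

theorem IsCharacteristic.unique {a : C(Strip, ℝ)} (ha : IsC1 a) (ha0 : ∀ p, a p ≠ 0)
    {x : unitInterval} {t : ℝ} {ω ω' : ℝ → ℝ} (h : IsCharacteristic a x t ω)
    (h' : IsCharacteristic a x t ω') : Set.EqOn ω ω' (Set.Icc 0 1) := by
  obtain ⟨K, hK⟩ := exists_lipschitz ha ha0
  intro ξ hξ
  have h1 := dist_le_both hK h.2 h'.2 x.2 hξ
  rw [h.1, h'.1, sub_self, abs_zero, zero_mul] at h1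
  exact sub_eq_zero.mp (abs_nonpos_iff.mp h1)

theorem continuousOn_characteristic {a : C(Strip, ℝ)} (ha : IsC1 a) (ha0 : ∀ p, a p ≠ 0)
    (x : unitInterval) (t : ℝ) : ContinuousOn (characteristic a x t) (Set.Icc 0 1) :=
  fun ξ hξ => ((characteristic_spec ha ha0 x t).2 ξ hξ).continuousWithinAt

theorem characteristic_add_period {a : C(Strip, ℝ)} (ha : IsC1 a) (ha0 : ∀ p, a p ≠ 0)
    (x : unitInterval) (t : ℝ) {ξ : ℝ} (hξ : ξ ∈ Set.Icc (0 : ℝ) 1) :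
    characteristic a x (t + 2 * Real.pi) ξ = characteristic a x t ξ + 2 * Real.pi := by
  have h := characteristic_spec ha ha0 x t
  refine (characteristic_spec ha ha0 x (t + 2 * Real.pi)).unique ha ha0
    (ω' := fun ξ => characteristic a x t ξ + 2 * Real.pi) ⟨?_, fun η hη => ?_⟩ hξ
  · simp only [h.1]
  · simp only [ev_add_period]
    exact (h.2 η hη).add_const _

/-- The characteristics depend continuously on `(ξ, x, t)`. -/
theorem continuous_characteristic {a : C(Strip, ℝ)} (ha : IsC1 a) (ha0 : ∀ p, a p ≠ 0) :
    Continuous (fun p : (unitInterval × ℝ) × ℝ =>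
      characteristic a p.1.1 p.1.2 (Set.projIcc 0 1 zero_le_one p.2)) := by
  obtain ⟨K, hK⟩ := exists_lipschitz ha ha0
  obtain ⟨M, hM⟩ := exists_bound ha0
  have hlip : ∀ (x : unitInterval) (t : ℝ), ∀ s ∈ Set.Icc (0 : ℝ) 1, ∀ r ∈ Set.Icc (0 : ℝ) 1,
      |characteristic a x t r - characteristic a x t s| ≤ M * |r - s| := by
    intro x t s hs r hr
    exact (convex_Icc (0 : ℝ) 1).norm_image_sub_le_of_norm_hasDerivWithin_le
      (fun ξ hξ => (characteristic_spec ha ha0 x t).2 ξ hξ) (fun ξ _ => hM _ _) hs hr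
  rw [continuous_iff_continuousAt]
  rintro ⟨⟨x, t⟩, ξ⟩
  have hbound : ∀ p : (unitInterval × ℝ) × ℝ,
      dist (characteristic a p.1.1 p.1.2 (Set.projIcc 0 1 zero_le_one p.2))
        (characteristic a x t (Set.projIcc 0 1 zero_le_one ξ)) ≤
      M * |((Set.projIcc 0 1 zero_le_one p.2 : unitInterval) : ℝ)
          - (Set.projIcc 0 1 zero_le_one ξ : unitInterval)|
        + (|p.1.2 - t| + M * |(p.1.1 : ℝ) - x|) * Real.exp K := by
    rintro ⟨⟨y, s⟩, η⟩
    simp only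
    set η' := Set.projIcc (0 : ℝ) 1 zero_le_one η
    set ξ' := Set.projIcc (0 : ℝ) 1 zero_le_one ξ
    have h1 := hlip y s ξ' ξ'.2 η' η'.2
    have h2 := dist_le_both hK (characteristic_spec ha ha0 y s).2
      (characteristic_spec ha ha0 x t).2 y.2 ξ'.2
    have h3 := hlip x t y y.2 x x.2
    rw [(characteristic_spec ha ha0 x t).1] at h3
    rw [(characteristic_spec ha ha0 y s).1] at h2
    have h4 : |s - characteristic a x t y| ≤ |s - t| + M * |(y : ℝ) - x| := by
      rw [abs_sub_comm (y : ℝ) x]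
      exact (abs_sub_le s t _).trans (by linarith)
    rw [Real.dist_eq]
    refine (abs_sub_le _ (characteristic a y s ξ') _).trans (add_le_add h1 (h2.trans ?_))
    exact mul_le_mul_of_nonneg_right h4 (Real.exp_pos _).le
  rw [ContinuousAt, tendsto_iff_dist_tendsto_zero]
  refine squeeze_zero (fun _ => dist_nonneg) hbound ?_
  have hcont : Continuous (fun p : (unitInterval × ℝ) × ℝ =>
      (M : ℝ) * |((Set.projIcc 0 1 zero_le_one p.2 : unitInterval) : ℝ)
          - (Set.projIcc 0 1 zero_le_one ξ : unitInterval)|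
        + (|p.1.2 - t| + M * |(p.1.1 : ℝ) - x|) * Real.exp K) := by
    have : Continuous (fun p : (unitInterval × ℝ) × ℝ => Set.projIcc (0 : ℝ) 1 zero_le_one p.2) :=
      continuous_projIcc.comp continuous_snd
    fun_prop
  have := hcont.tendsto ((x, t), ξ)
  simpa using this

/-! The operator `C` -/

theorem continuous_omega {a : Fin n → C(Strip, ℝ)} (ha : ∀ j, IsC1 (a j))
    (ha0 : ∀ j p, a j p ≠ 0) (j : Fin n) :
    Continuous (fun p : (unitInterval × ℝ) × ℝ =>
      omega a j (Set.projIcc 0 1 zero_le_one p.2 : unitInterval) p.1.1 p.1.2) :=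
  continuous_characteristic (ha j) (ha0 j)

theorem omega_add_period {a : Fin n → C(Strip, ℝ)} (ha : ∀ j, IsC1 (a j))
    (ha0 : ∀ j p, a j p ≠ 0) (j : Fin n) {ξ : ℝ} (hξ : ξ ∈ Set.Icc (0 : ℝ) 1)
    (x : unitInterval) (t : ℝ) :
    omega a j ξ x (t + 2 * Real.pi) = omega a j ξ x t + 2 * Real.pi :=
  characteristic_add_period (ha j) (ha0 j) x t hξ

theorem uIcc_subset (x y : unitInterval) : Set.uIcc (x : ℝ) y ⊆ Set.Icc 0 1 :=
  Set.uIcc_subset_Icc x.2 y.2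

theorem cCoef_eq (a : Fin n → C(Strip, ℝ)) (b : Fin n → Fin n → C(Strip, ℝ)) (j : Fin n)
    (ξ x : unitInterval) (t : ℝ) :
    cCoef a b j ξ x t = Real.exp (∫ η in (x : ℝ)..ξ,
      ev (b j j) η (omega a j (Set.projIcc 0 1 zero_le_one η : unitInterval) x t) /
      ev (a j) η (omega a j (Set.projIcc 0 1 zero_le_one η : unitInterval) x t)) := by
  unfold cCoef
  congr 1
  refine intervalIntegral.integral_congr (fun η hη => ?_)
  rw [Set.projIcc_of_mem zero_le_one (uIcc_subset x ξ hη)]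

theorem continuous_cCoef {a : Fin n → C(Strip, ℝ)} (ha : ∀ j, IsC1 (a j))
    (ha0 : ∀ j p, a j p ≠ 0) (b : Fin n → Fin n → C(Strip, ℝ)) (j : Fin n) :
    Continuous (fun p : (unitInterval × ℝ) × unitInterval =>
      cCoef a b j p.2 p.1.1 p.1.2) := by
  rw [funext fun p : (unitInterval × ℝ) × unitInterval => cCoef_eq a b j p.2 p.1.1 p.1.2]
  refine Real.continuous_exp.comp ?_
  have hω := continuous_omega ha ha0 j
  have hg : Continuous (fun p : (unitInterval × ℝ) × ℝ =>
      ev (b j j) p.2 (omega a j (Set.projIcc 0 1 zero_le_one p.2 : unitInterval) p.1.1 p.1.2) /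
      ev (a j) p.2 (omega a j (Set.projIcc 0 1 zero_le_one p.2 : unitInterval) p.1.1 p.1.2)) :=
    ((continuous_ev (b j j)).comp (continuous_snd.prodMk hω)).div
      ((continuous_ev (a j)).comp (continuous_snd.prodMk hω)) (fun p => ha0 j _)
  have h0 : ∀ p : (unitInterval × ℝ) × unitInterval,
      (∫ η in (p.1.1 : ℝ)..p.2,
        ev (b j j) η (omega a j (Set.projIcc 0 1 zero_le_one η : unitInterval) p.1.1 p.1.2) /
        ev (a j) η (omega a j (Set.projIcc 0 1 zero_le_one η : unitInterval) p.1.1 p.1.2)) =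
      (∫ η in (0 : ℝ)..p.2,
        ev (b j j) η (omega a j (Set.projIcc 0 1 zero_le_one η : unitInterval) p.1.1 p.1.2) /
        ev (a j) η (omega a j (Set.projIcc 0 1 zero_le_one η : unitInterval) p.1.1 p.1.2)) -
      (∫ η in (0 : ℝ)..p.1.1,
        ev (b j j) η (omega a j (Set.projIcc 0 1 zero_le_one η : unitInterval) p.1.1 p.1.2) /
        ev (a j) η (omega a j (Set.projIcc 0 1 zero_le_one η : unitInterval) p.1.1 p.1.2)) := by
    intro p
    have hi : ∀ y z : ℝ, IntervalIntegrable (fun η =>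
        ev (b j j) η (omega a j (Set.projIcc 0 1 zero_le_one η : unitInterval) p.1.1 p.1.2) /
        ev (a j) η (omega a j (Set.projIcc 0 1 zero_le_one η : unitInterval) p.1.1 p.1.2))
        MeasureTheory.volume y z := fun y z =>
      (hg.comp ((continuous_const (y := p.1)).prodMk continuous_id)).intervalIntegrable y z
    rw [intervalIntegral.integral_interval_sub_left (hi _ _) (hi _ _)]
  simp only [h0]
  refine Continuous.sub ?_ ?_
  · exact intervalIntegral.continuous_parametric_intervalIntegral_of_continuous
      (f := fun (p : (unitInterval × ℝ) × unitInterval) η =>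
        ev (b j j) η (omega a j (Set.projIcc 0 1 zero_le_one η : unitInterval) p.1.1 p.1.2) /
        ev (a j) η (omega a j (Set.projIcc 0 1 zero_le_one η : unitInterval) p.1.1 p.1.2))
      (hg.comp ((continuous_fst.comp continuous_fst).prodMk continuous_snd))
      (continuous_subtype_val.comp continuous_snd)
  · exact intervalIntegral.continuous_parametric_intervalIntegral_of_continuous
      (f := fun (p : (unitInterval × ℝ) × unitInterval) η =>
        ev (b j j) η (omega a j (Set.projIcc 0 1 zero_le_one η : unitInterval) p.1.1 p.1.2) /
        ev (a j) η (omega a j (Set.projIcc 0 1 zero_le_one η : unitInterval) p.1.1 p.1.2))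
      (hg.comp ((continuous_fst.comp continuous_fst).prodMk continuous_snd))
      (continuous_subtype_val.comp (continuous_fst.comp continuous_fst))

theorem cCoef_add_period {a : Fin n → C(Strip, ℝ)} (ha : ∀ j, IsC1 (a j))
    (ha0 : ∀ j p, a j p ≠ 0) (b : Fin n → Fin n → C(Strip, ℝ)) (j : Fin n)
    (ξ x : unitInterval) (t : ℝ) :
    cCoef a b j ξ x (t + 2 * Real.pi) = cCoef a b j ξ x t := by
  unfold cCoef
  congr 1
  refine intervalIntegral.integral_congr (fun η hη => ?_)
  rw [omega_add_period ha ha0 j (uIcc_subset x ξ hη), ev_add_period, ev_add_period]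

/-- A continuous function of `(x, t)` that is `2π`-periodic in `t`, as a function on the strip. -/
def ofPeriodic {E : Type*} [TopologicalSpace E] (g : unitInterval → ℝ → E)
    (hp : ∀ x, Function.Periodic (g x) (2 * Real.pi))
    (hc : Continuous (fun p : unitInterval × ℝ => g p.1 p.2)) : C(Strip, E) where
  toFun p := (hp p.1).lift p.2
  continuous_toFun := by
    have hq : IsOpenQuotientMap (Prod.map id ((↑) : ℝ → Circ) :
        unitInterval × ℝ → unitInterval × Circ) :=
      IsOpenQuotientMap.id.prodMap QuotientAddGroup.isOpenQuotientMap_mk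
    rw [← hq.continuous_comp_iff]
    exact hc

theorem ofPeriodic_apply {E : Type*} [TopologicalSpace E] (g : unitInterval → ℝ → E)
    (hp : ∀ x, Function.Periodic (g x) (2 * Real.pi))
    (hc : Continuous (fun p : unitInterval × ℝ => g p.1 p.2)) (x : unitInterval) (t : ℝ) :
    ofPeriodic g hp hc (x, (t : Circ)) = g x t := rfl

/-- The function `(Cv)_j(x,t) = c_j(x_j, x, t) (Rv)_j(ω_j(x_j, x, t))`, where `x_j = 0` for the
first `m` components and `x_j = 1` for the others. -/
def boundaryFun (m : ℕ) (a : Fin n → C(Strip, ℝ)) (b : Fin n → Fin n → C(Strip, ℝ))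
    (R : CPer n →L[ℝ] CPerTime n) (v : CPer n) (x : unitInterval) (t : ℝ) : Fin n → ℝ :=
  fun j => cCoef a b j (bdPoint m j) x t * R v (omega a j (bdPoint m j) x t : Circ) j

theorem continuous_boundaryFun (m : ℕ) {a : Fin n → C(Strip, ℝ)} (ha : ∀ j, IsC1 (a j))
    (ha0 : ∀ j p, a j p ≠ 0) (b : Fin n → Fin n → C(Strip, ℝ))
    (R : CPer n →L[ℝ] CPerTime n) (v : CPer n) :
    Continuous (fun p : unitInterval × ℝ => boundaryFun m a b R v p.1 p.2) := by
  refine continuous_pi (fun j => ?_)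
  have h1 := (continuous_cCoef ha ha0 b j).comp
    (continuous_id.prodMk (continuous_const (y := bdPoint m j)))
  have h2 := (continuous_omega ha ha0 j).comp
    (continuous_id.prodMk (continuous_const (y := (bdPoint m j : ℝ))))
  simp only [Function.comp_def, id, Set.projIcc_val] at h1 h2
  have h3 := (R v).continuous.comp ((AddCircle.continuous_mk' (2 * Real.pi)).comp h2)
  exact h1.mul ((continuous_apply j).comp h3)

theorem periodic_boundaryFun (m : ℕ) {a : Fin n → C(Strip, ℝ)} (ha : ∀ j, IsC1 (a j))
    (ha0 : ∀ j p, a j p ≠ 0) (b : Fin n → Fin n → C(Strip, ℝ))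
    (R : CPer n →L[ℝ] CPerTime n) (v : CPer n) (x : unitInterval) :
    Function.Periodic (boundaryFun m a b R v x) (2 * Real.pi) := by
  intro t
  funext j
  unfold boundaryFun
  rw [cCoef_add_period ha ha0, omega_add_period ha ha0 j (bdPoint m j).2,
    AddCircle.coe_add_period]

theorem exists_cCoef_bound (m : ℕ) {a : Fin n → C(Strip, ℝ)} (ha : ∀ j, IsC1 (a j))
    (ha0 : ∀ j p, a j p ≠ 0) (b : Fin n → Fin n → C(Strip, ℝ)) :
    ∃ M : ℝ, 0 ≤ M ∧ ∀ (j : Fin n) (x : unitInterval) (t : ℝ),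
      |cCoef a b j (bdPoint m j) x t| ≤ M := by
  have hj : ∀ j : Fin n, ∃ q : C(Strip, ℝ), ∀ (x : unitInterval) (t : ℝ),
      q (x, (t : Circ)) = cCoef a b j (bdPoint m j) x t := fun j =>
    ⟨ofPeriodic (fun x t => cCoef a b j (bdPoint m j) x t)
      (fun x t => cCoef_add_period ha ha0 b j _ x t)
      ((continuous_cCoef ha ha0 b j).comp
        (continuous_id.prodMk (continuous_const (y := bdPoint m j)))), fun x t => rfl⟩
  choose q hq using hj
  refine ⟨∑ j, ‖q j‖, Finset.sum_nonneg (fun j _ => norm_nonneg _), fun j x t => ?_⟩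
  rw [← hq]
  exact ((q j).norm_coe_le_norm _).trans
    (Finset.single_le_sum (f := fun j => ‖q j‖) (fun j _ => norm_nonneg _) (Finset.mem_univ j))

/-- The bounded linear operator `C` on `C_{n,2π}`. -/
def boundaryOp (m : ℕ) {a : Fin n → C(Strip, ℝ)} (ha : ∀ j, IsC1 (a j))
    (ha0 : ∀ j p, a j p ≠ 0) (b : Fin n → Fin n → C(Strip, ℝ))
    (R : CPer n →L[ℝ] CPerTime n) : CPer n →L[ℝ] CPer n :=
  LinearMap.mkContinuousOfExistsBound
    { toFun := fun v => ofPeriodic (boundaryFun m a b R v) (periodic_boundaryFun m ha ha0 b R v)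
        (continuous_boundaryFun m ha ha0 b R v)
      map_add' := by
        intro v w
        ext ⟨x, θ⟩ j
        induction θ using QuotientAddGroup.induction_on with
        | H t => simp [ofPeriodic_apply, boundaryFun, mul_add]
      map_smul' := by
        intro r v
        ext ⟨x, θ⟩ j
        induction θ using QuotientAddGroup.induction_on with
        | H t =>
          simp only [ofPeriodic_apply, boundaryFun, map_smul, ContinuousMap.smul_apply,
            Pi.smul_apply, smul_eq_mul, RingHom.id_apply]
          ring }
    (by
      obtain ⟨M, hM0, hM⟩ := exists_cCoef_bound m ha ha0 b
      refine ⟨M * ‖R‖, fun v => ?_⟩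
      refine (ContinuousMap.norm_le _ (by positivity)).mpr ?_
      rintro ⟨x, θ⟩
      refine (pi_norm_le_iff_of_nonneg (by positivity)).mpr (fun j => ?_)
      induction θ using QuotientAddGroup.induction_on with
      | H t =>
        change ‖cCoef a b j (bdPoint m j) x t * R v (omega a j (bdPoint m j) x t : Circ) j‖ ≤ _
        rw [norm_mul, mul_assoc]
        refine mul_le_mul (hM j x t) ?_ (norm_nonneg _) hM0
        exact ((norm_le_pi_norm _ j).trans ((R v).norm_coe_le_norm _)).trans (R.le_opNorm v))

theorem boundaryOp_apply (m : ℕ) {a : Fin n → C(Strip, ℝ)} (ha : ∀ j, IsC1 (a j))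
    (ha0 : ∀ j p, a j p ≠ 0) (b : Fin n → Fin n → C(Strip, ℝ))
    (R : CPer n →L[ℝ] CPerTime n) (v : CPer n) (x : unitInterval) (t : ℝ) (j : Fin n) :
    ev (boundaryOp m ha ha0 b R v) x t j =
      cCoef a b j (bdPoint m j) x t * R v (omega a j (bdPoint m j) x t : Circ) j := by
  rw [ev_coe]
  rfl

/-! The spaces of solutions and of solvable right-hand sides -/

theorem continuousOn_omega {a : Fin n → C(Strip, ℝ)} (ha : ∀ j, IsC1 (a j))
    (ha0 : ∀ j p, a j p ≠ 0) (j : Fin n) (x : unitInterval) (t : ℝ) :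
    ContinuousOn (fun ξ => omega a j ξ x t) (Set.Icc 0 1) :=
  continuousOn_characteristic (ha j) (ha0 j) x t

theorem continuousOn_ev_omega {E : Type*} [TopologicalSpace E] {a : Fin n → C(Strip, ℝ)}
    (ha : ∀ j, IsC1 (a j)) (ha0 : ∀ j p, a j p ≠ 0) (j : Fin n) (x : unitInterval) (t : ℝ)
    (u : C(Strip, E)) :
    ContinuousOn (fun ξ => ev u ξ (omega a j ξ x t)) (Set.Icc 0 1) :=
  (continuous_ev u).comp_continuousOn
    (continuousOn_id.prodMk (continuousOn_omega ha ha0 j x t))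

theorem continuousOn_dCoef {a : Fin n → C(Strip, ℝ)} (ha : ∀ j, IsC1 (a j))
    (ha0 : ∀ j p, a j p ≠ 0) (b : Fin n → Fin n → C(Strip, ℝ)) (j : Fin n)
    (x : unitInterval) (t : ℝ) :
    ContinuousOn (fun ξ => dCoef a b j ξ x t) (Set.Icc 0 1) := by
  refine ContinuousOn.div ?_ (continuousOn_ev_omega ha ha0 j x t (a j)) (fun ξ _ => ha0 j _)
  rw [continuousOn_iff_continuous_domRestrict]
  exact (continuous_cCoef ha ha0 b j).comp
    ((continuous_const (y := (x, t))).prodMk continuous_id)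

theorem intervalIntegrable_coupling {a : Fin n → C(Strip, ℝ)} (ha : ∀ j, IsC1 (a j))
    (ha0 : ∀ j p, a j p ≠ 0) (b : Fin n → Fin n → C(Strip, ℝ)) (j : Fin n)
    (x y : unitInterval) (t : ℝ) (u : CPer n) :
    IntervalIntegrable (fun ξ => dCoef a b j ξ x t *
      ∑ k ∈ Finset.univ.filter (fun k => k ≠ j),
        ev (b j k) ξ (omega a j ξ x t) * ev u ξ (omega a j ξ x t) k)
      MeasureTheory.volume y x := by
  refine ContinuousOn.intervalIntegrable (ContinuousOn.mono ?_ (uIcc_subset y x))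
  refine (continuousOn_dCoef ha ha0 b j x t).mul (continuousOn_finsetSum _ (fun k _ => ?_))
  exact (continuousOn_ev_omega ha ha0 j x t (b j k)).mul
    ((continuous_apply k).comp_continuousOn (continuousOn_ev_omega ha ha0 j x t u))

theorem intervalIntegrable_source {a : Fin n → C(Strip, ℝ)} (ha : ∀ j, IsC1 (a j))
    (ha0 : ∀ j p, a j p ≠ 0) (b : Fin n → Fin n → C(Strip, ℝ)) (j : Fin n)
    (x y : unitInterval) (t : ℝ) (f : CPer n) :
    IntervalIntegrable (fun ξ => dCoef a b j ξ x t * ev f ξ (omega a j ξ x t) j)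
      MeasureTheory.volume y x := by
  refine ContinuousOn.intervalIntegrable (ContinuousOn.mono ?_ (uIcc_subset y x))
  exact (continuousOn_dCoef ha ha0 b j x t).mul
    ((continuous_apply j).comp_continuousOn (continuousOn_ev_omega ha ha0 j x t f))

theorem isContinuousSolution_zero (m : ℕ) (a : Fin n → C(Strip, ℝ))
    (b : Fin n → Fin n → C(Strip, ℝ)) (R : CPer n →L[ℝ] CPerTime n) :
    IsContinuousSolution m a b R 0 0 := by
  intro j x t
  simp [ev]

theorem IsContinuousSolution.add {m : ℕ} {a : Fin n → C(Strip, ℝ)} (ha : ∀ j, IsC1 (a j))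
    (ha0 : ∀ j p, a j p ≠ 0) {b : Fin n → Fin n → C(Strip, ℝ)}
    {R : CPer n →L[ℝ] CPerTime n} {f g u v : CPer n}
    (hu : IsContinuousSolution m a b R f u) (hv : IsContinuousSolution m a b R g v) :
    IsContinuousSolution m a b R (f + g) (u + v) := by
  intro j x t
  have hev : ∀ (p q : CPer n) (ξ s : ℝ) (k : Fin n),
      ev (p + q) ξ s k = ev p ξ s k + ev q ξ s k := fun _ _ _ _ _ => rfl
  simp only [hev, mul_add, Finset.sum_add_distrib, map_add, ContinuousMap.add_apply,
    Pi.add_apply]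
  rw [intervalIntegral.integral_add (intervalIntegrable_coupling ha ha0 b j x _ t u)
      (intervalIntegrable_coupling ha ha0 b j x _ t v),
    intervalIntegral.integral_add (intervalIntegrable_source ha ha0 b j x _ t f)
      (intervalIntegrable_source ha ha0 b j x _ t g), hu j x t, hv j x t]
  ring

theorem IsContinuousSolution.smul {m : ℕ} {a : Fin n → C(Strip, ℝ)}
    {b : Fin n → Fin n → C(Strip, ℝ)}
    {R : CPer n →L[ℝ] CPerTime n} {f u : CPer n} (r : ℝ)
    (hu : IsContinuousSolution m a b R f u) :
    IsContinuousSolution m a b R (r • f) (r • u) := by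
  intro j x t
  have hev : ∀ (p : CPer n) (ξ s : ℝ) (k : Fin n),
      ev (r • p) ξ s k = r * ev p ξ s k := fun _ _ _ _ => rfl
  simp only [hev, mul_left_comm _ r, ← Finset.mul_sum, map_smul, ContinuousMap.smul_apply,
    Pi.smul_apply, smul_eq_mul, intervalIntegral.integral_const_mul]
  rw [hu j x t]
  ring

/-- The vector space `𝒦` of all continuous solutions with zero right-hand side. -/
def solutionKernel (m : ℕ) {a : Fin n → C(Strip, ℝ)} (ha : ∀ j, IsC1 (a j))
    (ha0 : ∀ j p, a j p ≠ 0) (b : Fin n → Fin n → C(Strip, ℝ))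
    (R : CPer n →L[ℝ] CPerTime n) : Submodule ℝ (CPer n) where
  carrier := {u | IsContinuousSolution m a b R 0 u}
  zero_mem' := isContinuousSolution_zero m a b R
  add_mem' := fun hu hv => by simpa using hu.add ha ha0 hv
  smul_mem' := fun r _ hu => by simpa using hu.smul r

/-- The vector space of all right-hand sides for which there is a continuous solution. -/
def solvableSpace (m : ℕ) {a : Fin n → C(Strip, ℝ)} (ha : ∀ j, IsC1 (a j))
    (ha0 : ∀ j p, a j p ≠ 0) (b : Fin n → Fin n → C(Strip, ℝ))
    (R : CPer n →L[ℝ] CPerTime n) : Submodule ℝ (CPer n) where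
  carrier := {f | ∃ u, IsContinuousSolution m a b R f u}
  zero_mem' := ⟨0, isContinuousSolution_zero m a b R⟩
  add_mem' := fun ⟨u, hu⟩ ⟨v, hv⟩ => ⟨u + v, hu.add ha ha0 hv⟩
  smul_mem' := fun r _ ⟨u, hu⟩ => ⟨r • u, hu.smul r⟩

end Hyperbolic

end

noncomputable section

namespace Hyperbolic

section Fredholm

variable {X : Type*} [NormedAddCommGroup X] [NormedSpace ℝ X]

theorem finiteDimensional_ker_one_sub {A : X →L[ℝ] X} (hA : IsCompactOperator A) :
    FiniteDimensional ℝ (1 - A : X →L[ℝ] X).ker := by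
  have hker : ∀ v ∈ (1 - A : X →L[ℝ] X).ker, A v = v := fun v hv => by
    have : v - A v = 0 := by simpa using hv
    exact (sub_eq_zero.mp this).symm
  have hcl : IsClosed ((1 - A : X →L[ℝ] X).ker : Set X) := (1 - A : X →L[ℝ] X).isClosed_ker
  have h := IsCompactOperator.restrict (f := (A : X →ₗ[ℝ] X)) hA
    (V := (1 - A : X →L[ℝ] X).ker) (fun v hv => by
      change A v ∈ _
      rw [hker v hv]
      exact hv) hcl
  refine FiniteDimensional.of_isCompactOperator_id (𝕜 := ℝ) ?_
  rwa [show ⇑((A : X →ₗ[ℝ] X).restrict _) = (id : (1 - A : X →L[ℝ] X).ker → _) from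
    funext fun v => Subtype.ext (hker v v.2)] at h

theorem bijective_one_sub_of_injective [CompleteSpace X] {A : X →L[ℝ] X}
    (hA : IsCompactOperator A) (hinj : Function.Injective (1 - A : X →L[ℝ] X)) :
    Function.Bijective (1 - A : X →L[ℝ] X) := by
  rcases hA.hasEigenvalue_or_mem_resolventSet (one_ne_zero (α := ℝ)) with h | h
  · obtain ⟨v, hv⟩ := h.exists_hasEigenvector
    have h1 : A v = v := by simpa using hv.apply_eq_smul
    refine absurd (hinj ?_) hv.2
    simp [h1]
  · rw [spectrum.mem_resolventSet_iff, map_one, ContinuousLinearMap.isUnit_iff_bijective] at h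
    exact h

/-- A surjective operator `1 - A` with `A` compact is injective: it has a right inverse, which is
an injective operator of the same form. -/
theorem bijective_one_sub_of_surjective [CompleteSpace X] {A : X →L[ℝ] X}
    (hA : IsCompactOperator A) (hsurj : Function.Surjective (1 - A : X →L[ℝ] X)) :
    Function.Bijective (1 - A : X →L[ℝ] X) := by
  have := finiteDimensional_ker_one_sub hA
  obtain ⟨P, hP⟩ := Submodule.ClosedComplemented.of_finiteDimensional (𝕜 := ℝ)
    (1 - A : X →L[ℝ] X).ker
  have hcl : IsClosed (P.ker : Set X) := P.isClosed_ker
  have : CompleteSpace P.ker := hcl.completeSpace_coe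
  let B : P.ker →L[ℝ] X := (1 - A : X →L[ℝ] X) ∘L P.ker.subtypeL
  have hB : ∀ x, B x = (1 - A : X →L[ℝ] X) x := fun _ => rfl
  have hBker : B.ker = ⊥ := by
    refine LinearMap.ker_eq_bot'.mpr (fun x hx => ?_)
    have h1 := hP ⟨x, hx⟩
    have h2 : P x = 0 := x.2
    rw [h2] at h1
    exact Subtype.ext (congrArg Subtype.val h1).symm
  have hBran : B.range = ⊤ := by
    refine LinearMap.range_eq_top.mpr (fun y => ?_)
    obtain ⟨x, rfl⟩ := hsurj y
    refine ⟨⟨x - P x, ?_⟩, ?_⟩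
    · change P (x - P x) = 0
      rw [map_sub, hP, sub_self]
    · have h3 : (1 - A : X →L[ℝ] X) (P x) = 0 := (P x).2
      change (1 - A : X →L[ℝ] X) (x - P x) = _
      rw [map_sub, h3, sub_zero]
  let e := ContinuousLinearEquiv.ofBijective B hBker hBran
  let S : X →L[ℝ] X := P.ker.subtypeL ∘L (e.symm : X →L[ℝ] P.ker)
  have hS : ∀ y, (1 - A : X →L[ℝ] X) (S y) = y := fun y =>
    ContinuousLinearEquiv.ofBijective_apply_symm_apply B hBker hBran y
  have hS' : S = 1 - (-(A ∘L S)) := by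
    ext y
    have := hS y
    simp only [sub_apply, one_apply_eq_self] at this
    simp [← sub_eq_iff_eq_add, this]
  have hc : IsCompactOperator (-(A ∘L S) : X →L[ℝ] X) := (hA.comp_clm S).neg
  have hSinj : Function.Injective S := Function.LeftInverse.injective hS
  have hSbij : Function.Bijective S := by
    rw [hS'] at hSinj ⊢
    exact bijective_one_sub_of_injective hc hSinj
  refine ⟨fun x y hxy => ?_, hsurj⟩
  obtain ⟨x, rfl⟩ := hSbij.2 x
  obtain ⟨y, rfl⟩ := hSbij.2 y
  rw [hS, hS] at hxy
  rw [hxy]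

/-- `L` has finite-dimensional kernel, and its range is the kernel of a bounded operator whose
range has the dimension of the kernel of `L`. -/
def IsFredholmIndexZero (L : X →L[ℝ] X) : Prop :=
  FiniteDimensional ℝ L.ker ∧ ∃ P : X →L[ℝ] X, P.ker = L.range ∧
    FiniteDimensional ℝ P.range ∧ Module.finrank ℝ P.range = Module.finrank ℝ L.ker

theorem isFredholmIndexZero_one_sub [CompleteSpace X] {A : X →L[ℝ] X}
    (hA : IsCompactOperator A) : IsFredholmIndexZero (1 - A : X →L[ℝ] X) := by
  have hfin := finiteDimensional_ker_one_sub hA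
  set T : X →L[ℝ] X := 1 - A with hT
  obtain ⟨P, hP⟩ := Submodule.ClosedComplemented.of_finiteDimensional (𝕜 := ℝ) T.ker
  have hTP : ∀ x, T (P x) = 0 := fun x => (P x).2
  obtain ⟨Q, hQ⟩ := Submodule.exists_isCompl T.range
  have key : ∀ J : T.ker →ₗ[ℝ] Q, Function.Injective J ∨ Function.Surjective J →
      ∃ V : X ≃L[ℝ] X, ∀ x, V x = T x + J (P x) := by
    intro J hJ
    let J' : T.ker →L[ℝ] X := LinearMap.toContinuousLinearMap (Q.subtype ∘ₗ J)
    let W : X →L[ℝ] X := J' ∘L P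
    have hW : ∀ x, W x = J (P x) := fun _ => rfl
    have hWc : IsCompactOperator W :=
      (isCompactOperator_of_locallyCompactSpace_rng J').comp_clm P
    have hc : IsCompactOperator (A - W : X →L[ℝ] X) := hA.sub hWc
    have hV : ∀ x, (1 - (A - W) : X →L[ℝ] X) x = T x + J (P x) := by
      intro x
      rw [← hW, hT]
      simp only [sub_apply]
      abel
    have hbij : Function.Bijective (1 - (A - W) : X →L[ℝ] X) := by
      rcases hJ with hJ | hJ
      · refine bijective_one_sub_of_injective hc ?_
        refine (injective_iff_map_eq_zero _).mpr (fun x hx => ?_)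
        rw [hV] at hx
        have h1 : T x ∈ T.range ⊓ Q := ⟨⟨x, rfl⟩, by
          rw [eq_neg_of_add_eq_zero_left hx]
          exact Q.neg_mem (J (P x)).2⟩
        rw [hQ.inf_eq_bot] at h1
        have h2 : T x = 0 := h1
        rw [h2, zero_add] at hx
        have h3 : P x = 0 := hJ (by rw [map_zero]; exact Subtype.ext hx)
        have h4 := hP ⟨x, h2⟩
        rw [h3] at h4
        exact (congrArg Subtype.val h4).symm
      · refine bijective_one_sub_of_surjective hc (fun y => ?_)
        have hy : y ∈ T.range ⊔ Q := by rw [hQ.sup_eq_top]; trivial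
        obtain ⟨_, ⟨u, rfl⟩, q, hq, rfl⟩ := Submodule.mem_sup.mp hy
        obtain ⟨z, hz⟩ := hJ ⟨q, hq⟩
        refine ⟨u - P u + z, ?_⟩
        have h1 : T z = 0 := z.2
        rw [hV]
        simp only [map_add, map_sub, hTP, h1, hP, hz, sub_self, zero_add, sub_zero, add_zero]
        rfl
    exact ⟨ContinuousLinearEquiv.ofBijective _ (LinearMap.ker_eq_bot.mpr hbij.1)
      (LinearMap.range_eq_top.mpr hbij.2), hV⟩
  have hex : ∃ V : X ≃L[ℝ] X, ∃ J : T.ker →ₗ[ℝ] Q, ∀ x, V x = T x + J (P x) := by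
    rcases le_total (Module.rank ℝ T.ker) (Module.rank ℝ Q) with h | h
    · obtain ⟨J, hJ⟩ := rank_le_iff_exists_linearMap.mp h
      obtain ⟨V, hV⟩ := key J (Or.inl hJ)
      exact ⟨V, J, hV⟩
    · obtain ⟨i, hi⟩ := rank_le_iff_exists_linearMap.mp h
      obtain ⟨J, hJ⟩ := i.exists_leftInverse_of_injective (LinearMap.ker_eq_bot.mpr hi)
      obtain ⟨V, hV⟩ := key J (Or.inr fun q => ⟨i q, LinearMap.congr_fun hJ q⟩)
      exact ⟨V, J, hV⟩
  obtain ⟨V, J, hV⟩ := hex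
  have hVT : ∀ x, V (x - P x) = T x := by
    intro x
    rw [hV]
    simp [hTP, hP]
  have hran : (T.ker.subtypeL ∘L P ∘L (V.symm : X →L[ℝ] X)).range = T.ker := by
    ext x
    constructor
    · rintro ⟨y, rfl⟩
      exact (P (V.symm y)).2
    · intro hx
      exact ⟨V x, by simpa using congrArg Subtype.val (hP ⟨x, hx⟩)⟩
  refine ⟨hfin, T.ker.subtypeL ∘L P ∘L (V.symm : X →L[ℝ] X), ?_, ?_, ?_⟩
  · ext y
    constructor
    · intro hy
      have h1 : P (V.symm y) = 0 := Subtype.ext hy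
      exact ⟨V.symm y, by simpa [h1] using (hVT (V.symm y)).symm⟩
    · rintro ⟨x, rfl⟩
      have : V.symm (T x) = x - P x := by rw [← hVT, V.symm_apply_apply]
      change ((P (V.symm (T x)) : T.ker) : X) = 0
      rw [this, map_sub, hP, sub_self, Submodule.coe_zero]
  · rw [hran]; exact hfin
  · rw [hran]

theorem IsFredholmIndexZero.units_mul_mul {L : X →L[ℝ] X} (hL : IsFredholmIndexZero L)
    (U V : (X →L[ℝ] X)ˣ) : IsFredholmIndexZero (U * L * V : X →L[ℝ] X) := by
  have hU : ∀ x, (↑U⁻¹ : X →L[ℝ] X) ((U : X →L[ℝ] X) x) = x := fun x =>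
    congrArg (fun S : X →L[ℝ] X => S x) U.inv_mul
  have hU' : ∀ x, (U : X →L[ℝ] X) ((↑U⁻¹ : X →L[ℝ] X) x) = x := fun x =>
    congrArg (fun S : X →L[ℝ] X => S x) U.mul_inv
  have hV : ∀ x, (↑V⁻¹ : X →L[ℝ] X) ((V : X →L[ℝ] X) x) = x := fun x =>
    congrArg (fun S : X →L[ℝ] X => S x) V.inv_mul
  have hV' : ∀ x, (V : X →L[ℝ] X) ((↑V⁻¹ : X →L[ℝ] X) x) = x := fun x =>
    congrArg (fun S : X →L[ℝ] X => S x) V.mul_inv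
  obtain ⟨hfin, P, hPk, hPf, hPr⟩ := hL
  have hker : (U * L * V : X →L[ℝ] X).ker =
      L.ker.map ((↑V⁻¹ : X →L[ℝ] X) : X →ₗ[ℝ] X) := by
    ext x
    constructor
    · intro hx
      have h0 : (U : X →L[ℝ] X) (L ((V : X →L[ℝ] X) x)) = 0 := hx
      refine ⟨(V : X →L[ℝ] X) x, ?_, hV x⟩
      have := hU (L ((V : X →L[ℝ] X) x))
      rw [h0, map_zero] at this
      exact this.symm
    · rintro ⟨y, hy, rfl⟩
      have h0 : L y = 0 := hy
      change (U : X →L[ℝ] X) (L ((V : X →L[ℝ] X) ((↑V⁻¹ : X →L[ℝ] X) y))) = 0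
      rw [hV', h0, map_zero]
  have hVinj : Function.Injective ((↑V⁻¹ : X →L[ℝ] X) : X →ₗ[ℝ] X) :=
    Function.LeftInverse.injective hV'
  have hran : (P * ↑U⁻¹ : X →L[ℝ] X).range = P.range := by
    ext y
    constructor
    · rintro ⟨x, rfl⟩
      exact ⟨(↑U⁻¹ : X →L[ℝ] X) x, rfl⟩
    · rintro ⟨x, rfl⟩
      exact ⟨(U : X →L[ℝ] X) x, congrArg P (hU x)⟩
  refine ⟨?_, P * ↑U⁻¹, ?_, ?_, ?_⟩
  · rw [hker]; infer_instance
  · ext y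
    have h1 : (↑U⁻¹ : X →L[ℝ] X) y ∈ P.ker ↔ (↑U⁻¹ : X →L[ℝ] X) y ∈ L.range := by rw [hPk]
    refine h1.trans ⟨?_, ?_⟩
    · rintro ⟨x, hx⟩
      refine ⟨(↑V⁻¹ : X →L[ℝ] X) x, ?_⟩
      change (U : X →L[ℝ] X) (L ((V : X →L[ℝ] X) ((↑V⁻¹ : X →L[ℝ] X) x))) = y
      rw [hV', ← hU' y]
      exact congrArg (U : X →L[ℝ] X) hx
    · rintro ⟨x, rfl⟩
      exact ⟨(V : X →L[ℝ] X) x, (hU _).symm⟩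
  · rw [hran]; exact hPf
  · rw [hran, hPr, hker]
    exact (Submodule.equivMapOfInjective _ hVinj _).finrank_eq

/-- If `K²` is compact, then `1 - K` is Fredholm of index zero: the product of `1 - K` with the
invertible operator `(1 + K / N)^N` is a compact perturbation of the identity. -/
theorem isFredholmIndexZero_one_sub_of_sq [CompleteSpace X] {K : X →L[ℝ] X}
    (hK : IsCompactOperator (K * K : X →L[ℝ] X)) :
    IsFredholmIndexZero (1 - K : X →L[ℝ] X) := by
  have hpow : ∀ (r : ℝ) (N : ℕ), ∃ g : X →L[ℝ] X,
      (1 + r • K) ^ N = 1 + (N * r) • K + K * K * g := by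
    intro r N
    induction N with
    | zero => exact ⟨0, by simp⟩
    | succ N ih =>
      obtain ⟨g, hg⟩ := ih
      refine ⟨g + (N * r * r) • 1 + r • (K * g), ?_⟩
      rw [pow_succ', hg]
      simp only [mul_add, add_mul, one_mul, mul_one, smul_mul_assoc, mul_smul_comm, smul_add,
        smul_smul, mul_assoc, Nat.cast_add, Nat.cast_one, add_smul]
      abel
  obtain ⟨N, hN⟩ := exists_nat_gt ‖K‖
  have hN0 : (0 : ℝ) < N := (norm_nonneg K).trans_lt hN
  obtain ⟨g, hg⟩ := hpow (N : ℝ)⁻¹ N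
  rw [mul_inv_cancel₀ hN0.ne', one_smul] at hg
  have hunit : IsUnit ((1 + (N : ℝ)⁻¹ • K) ^ N) := by
    refine IsUnit.pow _ ?_
    rw [← sub_neg_eq_add]
    refine isUnit_one_sub_of_norm_lt_one ?_
    rw [norm_neg, norm_smul, norm_inv, Real.norm_of_nonneg hN0.le, inv_mul_lt_iff₀ hN0, mul_one]
    exact hN
  obtain ⟨U, hU⟩ := hunit
  have hA : IsCompactOperator (K * K * (1 - g + K * g) : X →L[ℝ] X) := hK.comp_clm _
  have h1 : (1 - K) * (U : X →L[ℝ] X) = 1 - K * K * (1 - g + K * g) := by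
    rw [hU, hg]
    simp only [mul_add, sub_mul, mul_sub, one_mul, mul_one, mul_assoc]
    abel
  have h2 := (isFredholmIndexZero_one_sub hA).units_mul_mul 1 U⁻¹
  rwa [← h1, Units.val_one, one_mul, mul_assoc, U.mul_inv, mul_one] at h2

/-- The Fredholm alternative for the equation `u = C u - F B u + F f`, for an operator `C` with a
power of norm less than one. -/
theorem fredholm_alternative [CompleteSpace X] {C F B : X →L[ℝ] X}
    (hC : ∃ l : ℕ, ‖C ^ l‖ < 1)
    (hFBC : IsCompactOperator (F * B * C : X →L[ℝ] X))
    (hFBF : IsCompactOperator (F * B * F : X →L[ℝ] X)) :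
    FiniteDimensional ℝ (1 - C + F * B : X →L[ℝ] X).ker ∧
      ∃ G : X →L[ℝ] X,
        (∀ f, G f = 0 ↔ ∃ u, (1 - C + F * B : X →L[ℝ] X) u = F f) ∧
        FiniteDimensional ℝ G.range ∧
        Module.finrank ℝ G.range = Module.finrank ℝ (1 - C + F * B : X →L[ℝ] X).ker := by
  obtain ⟨l, hl⟩ := hC
  have hu : IsUnit (1 - C) := by
    have h1 := isUnit_one_sub_of_norm_lt_one hl
    rw [← mul_neg_geom_sum] at h1
    refine (Commute.isUnit_mul_iff ?_).mp h1 |>.1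
    exact (Commute.sum_right _ _ _ fun i _ =>
      ((Commute.one_left _).sub_left (Commute.refl C)).pow_right i)
  obtain ⟨U, hU⟩ := hu
  set V : X →L[ℝ] X := ↑U⁻¹ with hVdef
  have hV1 : V = 1 + C * V := by
    have : (1 - C) * V = 1 := by rw [← hU]; exact U.mul_inv
    rw [sub_mul, one_mul, sub_eq_iff_eq_add] at this
    exact this
  have hUV : (1 - C) * V = 1 := by rw [← hU]; exact U.mul_inv
  have hcomp : IsCompactOperator ((-(V * (F * B))) * (-(V * (F * B))) : X →L[ℝ] X) := by
    have h1 : (-(V * (F * B))) * (-(V * (F * B))) =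
        V * ((F * B * F) * B + (F * B * C) * (V * (F * B))) := by
      conv_lhs => rw [neg_mul_neg]; rw [mul_assoc V]; enter [2, 2]; rw [hV1]
      simp only [add_mul, mul_add, mul_assoc, one_mul]
    rw [h1]
    exact IsCompactOperator.clm_comp ((hFBF.comp_clm B).add (hFBC.comp_clm (V * (F * B)))) V
  have hL : (U : X →L[ℝ] X) * (1 - -(V * (F * B))) * ((1 : (X →L[ℝ] X)ˣ) : X →L[ℝ] X) =
      1 - C + F * B := by
    rw [Units.val_one, mul_one, hU, sub_neg_eq_add, mul_add, mul_one, ← mul_assoc, hUV, one_mul]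
  have hfred := (isFredholmIndexZero_one_sub_of_sq hcomp).units_mul_mul U 1
  rw [hL] at hfred
  obtain ⟨hfin, P, hPk, hPf, hPr⟩ := hfred
  have hran : (P * F : X →L[ℝ] X).range = P.range := by
    ext y
    constructor
    · rintro ⟨x, rfl⟩
      exact ⟨F x, rfl⟩
    · rintro ⟨x, rfl⟩
      have h1 : x = (1 - C) (V x) := (congrArg (fun S : X →L[ℝ] X => S x) hUV).symm
      have h2 : P ((1 - C + F * B : X →L[ℝ] X) (V x)) = 0 := by
        have : (1 - C + F * B : X →L[ℝ] X) (V x) ∈ P.ker := by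
          rw [hPk]; exact ⟨V x, rfl⟩
        exact this
      refine ⟨-(B (V x)), ?_⟩
      change P (F (-(B (V x)))) = P x
      conv_rhs => rw [h1]
      rw [add_apply, map_add, mul_apply_eq_comp] at h2
      rw [map_neg, map_neg, eq_comm]
      exact eq_neg_of_add_eq_zero_left h2
  refine ⟨hfin, P * F, fun f => ?_, ?_, ?_⟩
  · have : F f ∈ P.ker ↔ F f ∈ (1 - C + F * B : X →L[ℝ] X).range := by rw [hPk]
    exact this
  · rw [hran]; exact hPf
  · rw [hran]; exact hPr

end Fredholm

open Filter Topology

section Equicontinuity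

/-- Arzelà–Ascoli for bounded operators into a space of continuous functions. -/
theorem isCompactOperator_of_equicontinuousAt {X S E : Type*} [NormedAddCommGroup X]
    [NormedSpace ℝ X] [TopologicalSpace S] [CompactSpace S] [NormedAddCommGroup E]
    [NormedSpace ℝ E] [ProperSpace E] (T : X →L[ℝ] C(S, E))
    (h : ∀ p₀ : S, ∀ ε > 0, ∀ᶠ p in 𝓝 p₀, ∀ v : X, ‖v‖ ≤ 1 → ‖T v p - T v p₀‖ ≤ ε) :
    IsCompactOperator T := by
  change IsCompactOperator (T : X →ₗ[ℝ] C(S, E))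
  rw [isCompactOperator_iff_isCompact_closure_image_closedBall (T : X →ₗ[ℝ] C(S, E)) zero_lt_one]
  let e := ContinuousMap.isometryEquivBoundedOfCompact S E
  have hA := BoundedContinuousFunction.arzela_ascoli (Metric.closedBall (0 : E) ‖T‖)
    (isCompact_closedBall _ _) (e '' (T '' Metric.closedBall 0 1)) ?_ ?_
  · have h1 : e '' closure (T '' Metric.closedBall 0 1) =
        closure (e '' (T '' Metric.closedBall 0 1)) := e.toHomeomorph.image_closure _
    rw [← h1] at hA
    exact (e.toHomeomorph.isCompact_image).mp hA
  · rintro _ p ⟨_, ⟨v, hv, rfl⟩, rfl⟩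
    rw [mem_closedBall_zero_iff] at hv ⊢
    exact ((T v).norm_coe_le_norm p).trans ((T.le_opNorm v).trans
      (mul_le_of_le_one_right (norm_nonneg _) hv))
  · intro p₀
    rw [Metric.equicontinuousAt_iff_right]
    intro ε hε
    filter_upwards [h p₀ (ε / 2) (half_pos hε)] with p hp
    rintro ⟨_, _, ⟨v, hv, rfl⟩, rfl⟩
    rw [mem_closedBall_zero_iff] at hv
    rw [dist_comm, dist_eq_norm]
    exact (hp v hv).trans_lt (half_lt_self hε)

theorem abs_integral_sub_mul_integral_le {s r : ℝ} (hsr : s ≤ r) {G ψ ψ' : ℝ → ℝ} {h : ℝ → ℝ → ℝ}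
    (hG : Continuous G) (hψ : Continuous ψ) (hψ' : Continuous ψ')
    (hh : Continuous (Function.uncurry h))
    (hder : ∀ ξ ∈ Set.Ioo s r, HasDerivAt ψ (ψ' ξ) ξ) {g δ B M δ' : ℝ}
    (hδ : ∀ ξ ∈ Set.Icc s r, |G ξ - g| ≤ δ) (hB : ∀ ξ ∈ Set.Icc s r, |ψ' ξ| ≤ B)
    (hM : ∀ ξ ∈ Set.Icc s r, ∀ τ, |h ξ τ| ≤ M)
    (hδ' : ∀ ξ ∈ Set.Icc s r, ∀ τ, |h ξ τ - h s τ| ≤ δ') :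
    |(∫ ξ in s..r, G ξ * ψ' ξ * h ξ (ψ ξ)) - g * ∫ τ in ψ s..ψ r, h s τ| ≤
      (δ * B * M + |g| * B * δ') * (r - s) := by
  have hhs : Continuous (h s) := hh.comp (continuous_const.prodMk continuous_id)
  have hc1 : Continuous (fun ξ => G ξ * ψ' ξ * h ξ (ψ ξ)) :=
    (hG.mul hψ').mul (hh.comp (continuous_id.prodMk hψ))
  have hc2 : Continuous (fun ξ => g * ((h s ∘ ψ) ξ * ψ' ξ)) :=
    continuous_const.mul ((hhs.comp hψ).mul hψ')
  have h1 : ∫ ξ in s..r, (h s ∘ ψ) ξ * ψ' ξ = ∫ τ in ψ s..ψ r, h s τ := by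
    refine intervalIntegral.integral_comp_mul_deriv''' hψ.continuousOn (fun ξ hξ => ?_)
      hhs.continuousOn ?_ ?_
    · rw [min_eq_left hsr, max_eq_right hsr] at hξ
      exact (hder ξ hξ).hasDerivWithinAt
    · refine ContinuousOn.integrableOn_compact ?_ hhs.continuousOn
      exact isCompact_uIcc.image hψ
    · exact ((hhs.comp hψ).mul hψ').continuousOn.integrableOn_compact isCompact_uIcc
  rw [← h1, ← intervalIntegral.integral_const_mul,
    ← intervalIntegral.integral_sub (hc1.intervalIntegrable _ _) (hc2.intervalIntegrable _ _)]
  have h2 : ∀ ξ ∈ Set.uIoc s r,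
      ‖G ξ * ψ' ξ * h ξ (ψ ξ) - g * ((h s ∘ ψ) ξ * ψ' ξ)‖ ≤ δ * B * M + |g| * B * δ' := by
    intro ξ hξ
    rw [Set.uIoc_of_le hsr] at hξ
    have hξ' : ξ ∈ Set.Icc s r := ⟨hξ.1.le, hξ.2⟩
    have e1 : G ξ * ψ' ξ * h ξ (ψ ξ) - g * ((h s ∘ ψ) ξ * ψ' ξ) =
        (G ξ - g) * ψ' ξ * h ξ (ψ ξ) + g * ψ' ξ * (h ξ (ψ ξ) - h s (ψ ξ)) := by
      simp only [Function.comp]; ring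
    have hδ0 : 0 ≤ δ := (abs_nonneg _).trans (hδ ξ hξ')
    have hB0 : 0 ≤ B := (abs_nonneg _).trans (hB ξ hξ')
    rw [e1, Real.norm_eq_abs]
    refine (abs_add_le _ _).trans (add_le_add ?_ ?_)
    · rw [abs_mul, abs_mul]
      exact mul_le_mul (mul_le_mul (hδ ξ hξ') (hB ξ hξ') (abs_nonneg _) hδ0) (hM ξ hξ' _)
        (abs_nonneg _) (mul_nonneg hδ0 hB0)
    · rw [abs_mul, abs_mul]
      exact mul_le_mul (mul_le_mul_of_nonneg_left (hB ξ hξ') (abs_nonneg _)) (hδ' ξ hξ' _)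
        (abs_nonneg _) (mul_nonneg (abs_nonneg _) hB0)
  have h3 := intervalIntegral.norm_integral_le_of_norm_le_const h2
  rwa [Real.norm_eq_abs, abs_of_nonneg (sub_nonneg.mpr hsr)] at h3

theorem abs_integral_sub_integral_le {f : ℝ → ℝ} (hf : Continuous f) {M : ℝ}
    (hM : ∀ τ, |f τ| ≤ M) (u v u' v' : ℝ) :
    |(∫ τ in u..v, f τ) - ∫ τ in u'..v', f τ| ≤ M * (|u - u'| + |v - v'|) := by
  have h1 : (∫ τ in u..v, f τ) - ∫ τ in u'..v', f τ =
      (∫ τ in u..u', f τ) - ∫ τ in v..v', f τ :=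
    intervalIntegral.integral_interval_sub_interval_comm (hf.intervalIntegrable _ _)
      (hf.intervalIntegrable _ _) (hf.intervalIntegrable _ _)
  have h2 : ∀ a b : ℝ, |∫ τ in a..b, f τ| ≤ M * |b - a| := fun a b =>
    intervalIntegral.norm_integral_le_of_norm_le_const (f := f) (fun τ _ => hM τ)
  rw [h1]
  refine (abs_sub _ _).trans ((add_le_add (h2 _ _) (h2 _ _)).trans_eq ?_)
  rw [abs_sub_comm u', abs_sub_comm v', mul_add]

theorem eventually_forall_abs_sub_le {Y : Type*} [TopologicalSpace Y] {F : ℝ → Y → ℝ}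
    (hF : Continuous (Function.uncurry F)) (p₀ : Y) {ε : ℝ} (hε : 0 < ε) :
    ∀ᶠ p in 𝓝 p₀, ∀ ξ ∈ Set.Icc (0 : ℝ) 1, |F ξ p - F ξ p₀| ≤ ε := by
  refine isCompact_Icc.eventually_forall_of_forall_eventually (fun ξ _ => ?_)
  have hc : Continuous (fun z : Y × ℝ => |F z.2 z.1 - F z.2 p₀|) :=
    ((hF.comp (continuous_snd.prodMk continuous_fst)).sub
      (hF.comp (continuous_snd.prodMk continuous_const))).abs
  have := hc.continuousAt (x := (p₀, ξ))
  refine (this.eventually_lt (continuousAt_const (y := ε)) (by simpa using hε)).mono ?_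
  exact fun _ h => h.le

theorem exists_forall_abs_le {F : ℝ → ℝ} (hF : Continuous F) :
    ∃ B > 0, ∀ ξ ∈ Set.Icc (0 : ℝ) 1, |F ξ| ≤ B := by
  obtain ⟨B, hB⟩ := isCompact_Icc.exists_bound_of_continuousOn (s := Set.Icc (0 : ℝ) 1)
    hF.continuousOn
  exact ⟨max B 1, lt_max_of_lt_right one_pos, fun ξ hξ => (hB ξ hξ).trans (le_max_left _ _)⟩

/-- The integrals of `G ψ' h(ξ, ψ)` depend on the parameter continuously, uniformly over a family
of functions `h` which is bounded and Lipschitz in the first variable only: on short intervals the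
integral is nearly that of `G h(ξ, ·)` along `ψ`, with `ξ` frozen. -/
theorem eventually_abs_integral_sub_le_of_le {Y ι : Type*} [TopologicalSpace Y]
    {G ψ ψ' : ℝ → Y → ℝ} (hG : Continuous (Function.uncurry G))
    (hψ : Continuous (Function.uncurry ψ)) (hψ' : Continuous (Function.uncurry ψ'))
    (hder : ∀ p, ∀ ξ ∈ Set.Ioo (0 : ℝ) 1, HasDerivAt (fun ξ => ψ ξ p) (ψ' ξ p) ξ)
    {h : ι → ℝ → ℝ → ℝ} (hh : ∀ i, Continuous (Function.uncurry (h i))) {M : ℝ}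
    (hM0 : 0 ≤ M) (hM : ∀ i, ∀ ξ ∈ Set.Icc (0 : ℝ) 1, ∀ τ, |h i ξ τ| ≤ M)
    (hL : ∀ i, ∀ ξ ∈ Set.Icc (0 : ℝ) 1, ∀ η ∈ Set.Icc (0 : ℝ) 1, ∀ τ,
      |h i ξ τ - h i η τ| ≤ M * |ξ - η|)
    {α β : ℝ} (hα : α ∈ Set.Icc (0 : ℝ) 1) (hβ : β ∈ Set.Icc (0 : ℝ) 1) (hαβ : α ≤ β)
    (p₀ : Y) {ε : ℝ} (hε : 0 < ε) :
    ∀ᶠ p in 𝓝 p₀, ∀ i, |(∫ ξ in α..β, G ξ p * ψ' ξ p * h i ξ (ψ ξ p)) -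
      ∫ ξ in α..β, G ξ p₀ * ψ' ξ p₀ * h i ξ (ψ ξ p₀)| ≤ ε := by
  have sec : ∀ {F : ℝ → Y → ℝ}, Continuous (Function.uncurry F) → ∀ p, Continuous (F · p) :=
    fun hF p => hF.comp (continuous_id.prodMk continuous_const)
  obtain ⟨B, hB0, hB⟩ := exists_forall_abs_le (sec hψ' p₀)
  obtain ⟨Γ, hΓ0, hΓ⟩ := exists_forall_abs_le (sec hG p₀)
  set B' := B + 1 with hB'
  have hB'0 : 0 < B' := by positivity
  set δ := ε / (16 * (B' * M + 1)) with hδdef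
  have hδ0 : 0 < δ := by positivity
  have hδle : 4 * δ * B' * M ≤ ε / 4 := by
    have : 4 * δ * B' * M = ε / 4 * ((B' * M) / (B' * M + 1)) := by
      rw [hδdef]; field_simp; ring
    rw [this]
    refine mul_le_of_le_one_right (by positivity) ?_
    rw [div_le_one (by positivity)]
    linarith
  obtain ⟨ρ, hρ0, hρ⟩ := Metric.uniformContinuousOn_iff.mp
    (isCompact_Icc.uniformContinuousOn_of_continuous (s := Set.Icc (0 : ℝ) 1)
      (sec hG p₀).continuousOn) δ hδ0
  obtain ⟨N, hN⟩ := exists_nat_gt (max (1 / ρ) (8 * Γ * B' * M / ε))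
  have hN1 := (le_max_left _ _).trans_lt hN
  have hN2 := (le_max_right _ _).trans_lt hN
  have hN0 : (0 : ℝ) < N := (by positivity : 0 < 1 / ρ).trans hN1
  have hNρ : 1 / (N : ℝ) < ρ := by
    rw [div_lt_iff₀ hρ0] at hN1
    rw [div_lt_iff₀ hN0]; linarith
  have hNle : 2 * Γ * B' * M / N ≤ ε / 4 := by
    rw [div_lt_iff₀ hε] at hN2
    rw [div_le_iff₀ hN0]; linarith
  set η := ε / (4 * (N * Γ * M + 1)) with hηdef
  have hη0 : 0 < η := by positivity
  have hηle : N * (Γ * (M * (η + η))) ≤ ε / 2 := by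
    have : N * (Γ * (M * (η + η))) = ε / 2 * ((N * Γ * M) / (N * Γ * M + 1)) := by
      rw [hηdef]; field_simp; ring
    rw [this]
    refine mul_le_of_le_one_right (by positivity) ?_
    rw [div_le_one (by positivity)]
    linarith
  filter_upwards [eventually_forall_abs_sub_le hG p₀ hδ0, eventually_forall_abs_sub_le hψ p₀ hη0,
    eventually_forall_abs_sub_le hψ' p₀ one_pos] with p hpG hpψ hpψ' i
  set κ := (β - α) / N with hκ
  have hκ0 : 0 ≤ κ := div_nonneg (sub_nonneg.mpr hαβ) hN0.le
  have hκN : κ ≤ 1 / N := by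
    rw [hκ]; gcongr; linarith [hα.1, hβ.2]
  let a : ℕ → ℝ := fun k => α + k * κ
  have ha0 : a 0 = α := by simp [a]
  have haN : a N = β := by simp only [a, hκ]; field_simp; ring
  have hasucc : ∀ k, a (k + 1) - a k = κ := fun k => by simp only [a]; push_cast; ring
  have hale : ∀ k, a k ≤ a (k + 1) := fun k => by linarith [hasucc k]
  have hmem : ∀ k ≤ N, a k ∈ Set.Icc (0 : ℝ) 1 := by
    intro k hk
    have hk' : (k : ℝ) ≤ N := by exact_mod_cast hk
    have h1 : (k : ℝ) * κ ≤ N * κ := mul_le_mul_of_nonneg_right hk' hκ0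
    have h2 : (N : ℝ) * κ = β - α := by rw [hκ]; field_simp
    have h3 : 0 ≤ (k : ℝ) * κ := by positivity
    exact ⟨by simp only [a]; linarith [hα.1], by simp only [a]; linarith [hβ.2]⟩
  have hcont : ∀ q, Continuous (fun ξ => G ξ q * ψ' ξ q * h i ξ (ψ ξ q)) := fun q =>
    ((sec hG q).mul (sec hψ' q)).mul ((hh i).comp (continuous_id.prodMk (sec hψ q)))
  have hsum : ∀ q, ∑ k ∈ Finset.range N,
      (∫ ξ in a k..a (k + 1), G ξ q * ψ' ξ q * h i ξ (ψ ξ q)) =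
      ∫ ξ in α..β, G ξ q * ψ' ξ q * h i ξ (ψ ξ q) := by
    intro q
    rw [intervalIntegral.sum_integral_adjacent_intervals
      (fun k _ => (hcont q).intervalIntegrable _ _), ha0, haN]
  rw [← hsum, ← hsum, ← Finset.sum_sub_distrib]
  have hpiece : ∀ k ∈ Finset.range N,
      |(∫ ξ in a k..a (k + 1), G ξ p * ψ' ξ p * h i ξ (ψ ξ p)) -
        ∫ ξ in a k..a (k + 1), G ξ p₀ * ψ' ξ p₀ * h i ξ (ψ ξ p₀)| ≤
      2 * ((2 * δ * B' * M + Γ * B' * (M / N)) * κ) + Γ * (M * (η + η)) := by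
    intro k hk
    rw [Finset.mem_range] at hk
    have hs := hmem k hk.le
    have hr := hmem (k + 1) hk
    have hsub : Set.Icc (a k) (a (k + 1)) ⊆ Set.Icc 0 1 := Set.Icc_subset_Icc hs.1 hr.2
    have hdist : ∀ ξ ∈ Set.Icc (a k) (a (k + 1)), |ξ - a k| ≤ 1 / N := by
      intro ξ hξ
      rw [abs_of_nonneg (sub_nonneg.mpr hξ.1)]
      linarith [hasucc k, hξ.2]
    have hosc : ∀ ξ ∈ Set.Icc (a k) (a (k + 1)), |G ξ p₀ - G (a k) p₀| ≤ δ := fun ξ hξ =>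
      (hρ ξ (hsub hξ) (a k) hs ((hdist ξ hξ).trans_lt hNρ)).le
    have hLip : ∀ ξ ∈ Set.Icc (a k) (a (k + 1)), ∀ τ, |h i ξ τ - h i (a k) τ| ≤ M / N := by
      intro ξ hξ τ
      refine (hL i ξ (hsub hξ) _ hs τ).trans ?_
      rw [div_eq_mul_one_div]
      exact mul_le_mul_of_nonneg_left (hdist ξ hξ) hM0
    have hgen : ∀ q, (∀ ξ ∈ Set.Icc (0 : ℝ) 1, |G ξ q - G ξ p₀| ≤ δ) →
        (∀ ξ ∈ Set.Icc (0 : ℝ) 1, |ψ' ξ q - ψ' ξ p₀| ≤ 1) →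
        |(∫ ξ in a k..a (k + 1), G ξ q * ψ' ξ q * h i ξ (ψ ξ q)) -
          G (a k) p₀ * ∫ τ in ψ (a k) q..ψ (a (k + 1)) q, h i (a k) τ| ≤
        (2 * δ * B' * M + Γ * B' * (M / N)) * κ := by
      intro q hq1 hq2
      have h1 := abs_integral_sub_mul_integral_le (hale k) (sec hG q) (sec hψ q) (sec hψ' q)
        (hh i) (fun ξ hξ => hder q ξ ⟨hs.1.trans_lt hξ.1, hξ.2.trans_le hr.2⟩)
        (g := G (a k) p₀) (δ := 2 * δ) (B := B') (M := M) (δ' := M / N)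
        (fun ξ hξ => ?_) (fun ξ hξ => ?_) (fun ξ hξ => hM i ξ (hsub hξ)) hLip
      · rw [hasucc] at h1
        refine h1.trans ?_
        gcongr
        exact hΓ _ hs
      · have := abs_sub_le (G ξ q) (G ξ p₀) (G (a k) p₀)
        linarith [hosc ξ hξ, hq1 ξ (hsub hξ)]
      · have := abs_sub_le (ψ' ξ q) (ψ' ξ p₀) 0
        simp only [sub_zero] at this
        linarith [hq2 ξ (hsub hξ), hB ξ (hsub hξ)]
    have e1 := hgen p hpG hpψ'
    have e2 := hgen p₀ (fun ξ _ => by simp [hδ0.le]) (fun ξ _ => by simp)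
    have e3 : |G (a k) p₀ * (∫ τ in ψ (a k) p..ψ (a (k + 1)) p, h i (a k) τ) -
        G (a k) p₀ * ∫ τ in ψ (a k) p₀..ψ (a (k + 1)) p₀, h i (a k) τ| ≤
        Γ * (M * (η + η)) := by
      rw [← mul_sub, abs_mul]
      refine mul_le_mul (hΓ _ hs) ?_ (abs_nonneg _) hΓ0.le
      refine (abs_integral_sub_integral_le ((hh i).comp (continuous_const.prodMk continuous_id))
        (hM i _ hs) _ _ _ _).trans ?_
      exact mul_le_mul_of_nonneg_left (add_le_add (hpψ _ hs) (hpψ _ hr)) hM0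
    rw [abs_le] at *
    constructor <;> linarith [e1.1, e1.2, e2.1, e2.2, e3.1, e3.2]
  refine (Finset.abs_sum_le_sum_abs _ _).trans ((Finset.sum_le_sum hpiece).trans ?_)
  rw [Finset.sum_const, Finset.card_range, nsmul_eq_mul, mul_add]
  have hκ1 : (N : ℝ) * κ ≤ 1 := by
    calc (N : ℝ) * κ ≤ N * (1 / N) := mul_le_mul_of_nonneg_left hκN hN0.le
      _ = 1 := by field_simp
  have hE0 : 0 ≤ 2 * (2 * δ * B' * M + Γ * B' * (M / N)) := by positivity
  have h5 : (N : ℝ) * (2 * ((2 * δ * B' * M + Γ * B' * (M / N)) * κ)) ≤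
      2 * (2 * δ * B' * M + Γ * B' * (M / N)) := by
    calc _ = 2 * (2 * δ * B' * M + Γ * B' * (M / N)) * (N * κ) := by ring
      _ ≤ _ := mul_le_of_le_one_right hE0 hκ1
  have h6 : 2 * (2 * δ * B' * M + Γ * B' * (M / N)) =
      4 * δ * B' * M + 2 * Γ * B' * M / N := by ring
  linarith

theorem eventually_abs_integral_sub_le {Y ι : Type*} [TopologicalSpace Y]
    {G ψ ψ' : ℝ → Y → ℝ} (hG : Continuous (Function.uncurry G))
    (hψ : Continuous (Function.uncurry ψ)) (hψ' : Continuous (Function.uncurry ψ'))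
    (hder : ∀ p, ∀ ξ ∈ Set.Ioo (0 : ℝ) 1, HasDerivAt (fun ξ => ψ ξ p) (ψ' ξ p) ξ)
    {h : ι → ℝ → ℝ → ℝ} (hh : ∀ i, Continuous (Function.uncurry (h i))) {M : ℝ}
    (hM0 : 0 ≤ M) (hM : ∀ i, ∀ ξ ∈ Set.Icc (0 : ℝ) 1, ∀ τ, |h i ξ τ| ≤ M)
    (hL : ∀ i, ∀ ξ ∈ Set.Icc (0 : ℝ) 1, ∀ η ∈ Set.Icc (0 : ℝ) 1, ∀ τ,
      |h i ξ τ - h i η τ| ≤ M * |ξ - η|)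
    {α β : ℝ} (hα : α ∈ Set.Icc (0 : ℝ) 1) (hβ : β ∈ Set.Icc (0 : ℝ) 1)
    (p₀ : Y) {ε : ℝ} (hε : 0 < ε) :
    ∀ᶠ p in 𝓝 p₀, ∀ i, |(∫ ξ in α..β, G ξ p * ψ' ξ p * h i ξ (ψ ξ p)) -
      ∫ ξ in α..β, G ξ p₀ * ψ' ξ p₀ * h i ξ (ψ ξ p₀)| ≤ ε := by
  rcases le_total α β with hαβ | hαβ
  · exact eventually_abs_integral_sub_le_of_le hG hψ hψ' hder hh hM0 hM hL hα hβ hαβ p₀ hε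
  · have h1 := eventually_abs_integral_sub_le_of_le hG hψ hψ' hder hh hM0 hM hL hβ hα hαβ p₀ hε
    simp only [intervalIntegral.integral_symm β α, neg_sub_neg]
    simpa only [abs_sub_comm] using h1

end Equicontinuity

variable {n : ℕ}

section Characteristics

theorem characteristic_characteristic {a : C(Strip, ℝ)} (ha : IsC1 a) (ha0 : ∀ p, a p ≠ 0)
    (x y : unitInterval) (t : ℝ) {η : ℝ} (hη : η ∈ Set.Icc (0 : ℝ) 1) :
    characteristic a y (characteristic a x t y) η = characteristic a x t η :=
  (characteristic_spec ha ha0 y _).unique ha ha0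
    ⟨rfl, (characteristic_spec ha ha0 x t).2⟩ hη

theorem eq_mul_exp_integral {m Q : ℝ → ℝ} (hQ : Continuous Q)
    (hm : ∀ η ∈ Set.Icc (0 : ℝ) 1, HasDerivWithinAt m (Q η * m η) (Set.Icc 0 1) η)
    {s r : ℝ} (hs : s ∈ Set.Icc (0 : ℝ) 1) (hr : r ∈ Set.Icc (0 : ℝ) 1) :
    m r = m s * Real.exp (∫ η in s..r, Q η) := by
  let N : ℝ → ℝ := fun η => m η * Real.exp (-∫ θ in s..η, Q θ)
  have hN : ∀ η ∈ Set.Icc (0 : ℝ) 1, HasDerivWithinAt N 0 (Set.Icc 0 1) η := by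
    intro η hη
    have h1 : HasDerivAt (fun η => ∫ θ in s..η, Q θ) (Q η) η :=
      intervalIntegral.integral_hasDerivAt_right (hQ.intervalIntegrable _ _)
        (hQ.stronglyMeasurableAtFilter _ _) hQ.continuousAt
    have h2 := (hm η hη).mul h1.neg.exp.hasDerivWithinAt
    refine h2.congr_deriv ?_
    simp only [Pi.neg_apply]
    ring
  have h3 := (convex_Icc (0 : ℝ) 1).norm_image_sub_le_of_norm_hasDerivWithin_le (C := 0)
    hN (fun _ _ => by simp) hs hr
  rw [zero_mul, norm_le_zero_iff, sub_eq_zero] at h3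
  have h4 : N s = m s := by simp [N]
  rw [h4] at h3
  rw [← h3, mul_assoc, ← Real.exp_add, neg_add_cancel, Real.exp_zero, mul_one]

theorem hasDerivAt_mul_of_eq_zero {f e : ℝ → ℝ} {f' x : ℝ} (hf : HasDerivAt f f' x)
    (h0 : f x = 0) (he : ContinuousAt e x) : HasDerivAt (fun y => f y * e y) (f' * e x) x := by
  rw [hasDerivAt_iff_tendsto_slope] at hf ⊢
  refine (hf.mul (he.tendsto.mono_left nhdsWithin_le_nhds)).congr (fun y => ?_)
  simp only [slope_def_field, h0]
  ring

theorem hasDerivAt_one_div_ev {a ax at' : C(Strip, ℝ)} (h : HasPartials a ax at')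
    (ha0 : ∀ p, a p ≠ 0) (ξ s : ℝ) :
    HasDerivAt (fun s => 1 / ev a ξ s) (-ev at' ξ s / ev a ξ s ^ 2) s := by
  have h1 := (h (Set.projIcc 0 1 zero_le_one ξ) s).2
  simp only [ev_coe] at h1
  have h2 := h1.inv (ha0 _)
  simpa [ev, one_div] using! h2

theorem exists_difference_quotient {v q : ℝ → ℝ → ℝ} (hq : Continuous (Function.uncurry q))
    (hv : ∀ ξ s, HasDerivAt (v ξ) (q ξ s) s) :
    ∃ Q : ℝ × ℝ × ℝ → ℝ, Continuous Q ∧ (∀ ξ s, Q (ξ, s, s) = q ξ s) ∧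
      ∀ ξ s r, v ξ r - v ξ s = Q (ξ, s, r) * (r - s) := by
  refine ⟨fun z => ∫ θ in (0 : ℝ)..1, q z.1 (z.2.1 + θ * (z.2.2 - z.2.1)), ?_, ?_, ?_⟩
  · refine intervalIntegral.continuous_parametric_intervalIntegral_of_continuous'
      (f := fun (z : ℝ × ℝ × ℝ) θ => q z.1 (z.2.1 + θ * (z.2.2 - z.2.1))) ?_ 0 1
    exact hq.comp (f := fun w : (ℝ × ℝ × ℝ) × ℝ =>
      (w.1.1, w.1.2.1 + w.2 * (w.1.2.2 - w.1.2.1))) (by fun_prop)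
  · intro ξ s
    simp
  · intro ξ s r
    have h1 : ∀ θ ∈ Set.uIcc (0 : ℝ) 1, HasDerivAt (fun θ => v ξ (s + θ * (r - s)))
        (q ξ (s + θ * (r - s)) * (r - s)) θ := by
      intro θ _
      have h2 : HasDerivAt (fun θ : ℝ => s + θ * (r - s)) (r - s) θ := by
        simpa using ((hasDerivAt_id θ).mul_const (r - s)).const_add s
      exact (hv ξ (s + θ * (r - s))).comp θ h2
    have hc : Continuous (fun θ => q ξ (s + θ * (r - s)) * (r - s)) :=
      (hq.comp (f := fun θ : ℝ => (ξ, s + θ * (r - s))) (by fun_prop)).mul continuous_const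
    have h3 := intervalIntegral.integral_eq_sub_of_hasDerivAt h1 (hc.intervalIntegrable _ _)
    rw [intervalIntegral.integral_mul_const] at h3
    simpa using h3.symm

/-- The derivative of `ξ ↦ ω(x₁, ξ, y(ξ))`: the time shift `y(ξ) - ω(ξ, ξ₀, y(ξ₀))` is propagated
to `x₁` by a linear differential equation. -/
theorem hasDerivAt_characteristic_comp {a ax at' : C(Strip, ℝ)} (h : HasPartials a ax at')
    (ha0 : ∀ p, a p ≠ 0) (x₁ : unitInterval) {y : ℝ → ℝ} (hy : Continuous y) {ξ₀ y' : ℝ}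
    (hξ₀ : ξ₀ ∈ Set.Ioo (0 : ℝ) 1) (hy' : HasDerivAt y y' ξ₀) :
    HasDerivAt (fun ξ => characteristic a (Set.projIcc 0 1 zero_le_one ξ) (y ξ) x₁)
      ((y' - 1 / ev a ξ₀ (y ξ₀)) * Real.exp (∫ η in ξ₀..x₁,
        -ev at' η (characteristic a (Set.projIcc 0 1 zero_le_one ξ₀) (y ξ₀) η) /
          ev a η (characteristic a (Set.projIcc 0 1 zero_le_one ξ₀) (y ξ₀) η) ^ 2)) ξ₀ := by
  have ha : IsC1 a := ⟨ax, at', h⟩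
  have hξ₀' : ξ₀ ∈ Set.Icc (0 : ℝ) 1 := Set.Ioo_subset_Icc_self hξ₀
  have hq : Continuous (Function.uncurry fun ξ s => -ev at' ξ s / ev a ξ s ^ 2) :=
    (continuous_ev at').neg.div ((continuous_ev a).pow 2) (fun p => pow_ne_zero 2 (ha0 _))
  obtain ⟨Q, hQc, hQd, hQv⟩ := exists_difference_quotient hq
    (v := fun ξ s => 1 / ev a ξ s) (hasDerivAt_one_div_ev h ha0)
  let π : ℝ → unitInterval := Set.projIcc 0 1 zero_le_one
  have hπ : Continuous π := continuous_projIcc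
  have hπv : ∀ {ξ : ℝ}, ξ ∈ Set.Icc (0 : ℝ) 1 → ((π ξ : unitInterval) : ℝ) = ξ := fun hξ => by
    simp only [π]; rw [Set.projIcc_of_mem zero_le_one hξ]
  let w : ℝ → ℝ → ℝ := fun ξ η => characteristic a (π ξ) (y ξ) η
  have hw : ∀ ξ, IsCharacteristic a (π ξ) (y ξ) (w ξ) := fun ξ => characteristic_spec ha ha0 _ _
  have hwc : Continuous (fun p : ℝ × ℝ => w p.1 (π p.2)) :=
    (continuous_characteristic ha ha0).comp (f := fun p : ℝ × ℝ => ((π p.1, y p.1), p.2))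
      (by fun_prop)
  let F : ℝ → ℝ → ℝ := fun ξ η => Q (η, w ξ₀ (π η), w ξ (π η))
  have hF : Continuous (Function.uncurry F) := by
    have h1 : Continuous (fun p : ℝ × ℝ => w ξ₀ (π p.2)) :=
      hwc.comp (f := fun p : ℝ × ℝ => (ξ₀, p.2)) (by fun_prop)
    exact hQc.comp (continuous_snd.prodMk (h1.prodMk hwc))
  have hdiff : ∀ ξ ∈ Set.Icc (0 : ℝ) 1, w ξ x₁ - w ξ₀ x₁ =
      (y ξ - w ξ₀ ξ) * Real.exp (∫ η in ξ..x₁, F ξ η) := by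
    intro ξ hξ
    have h1 := eq_mul_exp_integral (m := fun η => w ξ η - w ξ₀ η) (Q := F ξ)
      (hF.comp (continuous_const.prodMk continuous_id)) (fun η hη => ?_) hξ x₁.2
    · have h2 := (hw ξ).1
      rw [hπv hξ] at h2
      simp only [h2] at h1
      exact h1
    · have h3 := ((hw ξ).2 η hη).sub ((hw ξ₀).2 η hη)
      rw [hQv] at h3
      simp only [F, hπv hη]
      exact h3
  have hEc : Continuous (fun ξ => Real.exp (∫ η in ξ..x₁, F ξ η)) := by
    refine Real.continuous_exp.comp ?_
    simp only [intervalIntegral.integral_symm (x₁ : ℝ)]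
    exact (intervalIntegral.continuous_parametric_intervalIntegral_of_continuous hF
      continuous_id).neg
  have hz : HasDerivAt (w ξ₀) (1 / ev a ξ₀ (y ξ₀)) ξ₀ := by
    have h1 := ((hw ξ₀).2 ξ₀ hξ₀').hasDerivAt (Icc_mem_nhds hξ₀.1 hξ₀.2)
    have h2 := (hw ξ₀).1
    rw [hπv hξ₀'] at h2
    rwa [h2] at h1
  have hz0 : w ξ₀ ξ₀ = y ξ₀ := by
    have h2 := (hw ξ₀).1
    rwa [hπv hξ₀'] at h2
  have hmain := (hasDerivAt_mul_of_eq_zero (hy'.sub hz) (by simp [hz0]) hEc.continuousAt).add_const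
    (w ξ₀ x₁)
  have hexp : ∫ η in ξ₀..x₁, F ξ₀ η = ∫ η in ξ₀..x₁,
      -ev at' η (characteristic a (π ξ₀) (y ξ₀) η) /
        ev a η (characteristic a (π ξ₀) (y ξ₀) η) ^ 2 := by
    refine intervalIntegral.integral_congr (fun η hη => ?_)
    simp only [F]
    rw [hQd, hπv (Set.uIcc_subset_Icc hξ₀' x₁.2 hη)]
  rw [hexp] at hmain
  refine hmain.congr_of_eventuallyEq ?_
  filter_upwards [Icc_mem_nhds hξ₀.1 hξ₀.2] with ξ hξ
  have := hdiff ξ hξ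
  simp only [Pi.sub_apply]
  rw [← this, sub_add_cancel]

/-- The factor in the derivative of `ξ ↦ ω_k(x₁, ξ, y(ξ))` has the form of the coefficient `c_k`
for another zeroth-order term. -/
theorem exists_hasDerivAt_omega_comp {a : Fin n → C(Strip, ℝ)} (ha : ∀ j, IsC1 (a j))
    (ha0 : ∀ j p, a j p ≠ 0) :
    ∃ b' : Fin n → Fin n → C(Strip, ℝ), ∀ (k : Fin n) (x₁ : unitInterval) (y : ℝ → ℝ),
      Continuous y → ∀ ξ ∈ Set.Ioo (0 : ℝ) 1, ∀ y' : ℝ, HasDerivAt y y' ξ →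
      HasDerivAt (fun ξ => omega a k x₁ (Set.projIcc 0 1 zero_le_one ξ) (y ξ))
        ((y' - 1 / ev (a k) ξ (y ξ)) *
          cCoef a b' k x₁ (Set.projIcc 0 1 zero_le_one ξ) (y ξ)) ξ := by
  choose ax at' h using ha
  refine ⟨fun k _ => ⟨fun p => -at' k p / a k p,
    (at' k).continuous.neg.div (a k).continuous (ha0 k)⟩, fun k x₁ y hy ξ hξ y' hy' => ?_⟩
  have h1 := hasDerivAt_characteristic_comp (h k) (ha0 k) x₁ hy hξ hy'
  have h2 : ∫ η in ξ..x₁, -ev (at' k) η (omega a k η (Set.projIcc 0 1 zero_le_one ξ) (y ξ)) /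
        ev (a k) η (omega a k η (Set.projIcc 0 1 zero_le_one ξ) (y ξ)) /
        ev (a k) η (omega a k η (Set.projIcc 0 1 zero_le_one ξ) (y ξ)) =
      ∫ η in ξ..x₁, -ev (at' k) η (omega a k η (Set.projIcc 0 1 zero_le_one ξ) (y ξ)) /
        ev (a k) η (omega a k η (Set.projIcc 0 1 zero_le_one ξ) (y ξ)) ^ 2 := by
    simp only [div_div, sq]
  have h3 : ((Set.projIcc 0 1 zero_le_one ξ : unitInterval) : ℝ) = ξ := by
    rw [Set.projIcc_of_mem zero_le_one (Set.Ioo_subset_Icc_self hξ)]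
  unfold cCoef
  rw [h3]
  exact h2 ▸ h1

end Characteristics

section Operators

/-- The point of `[0,1]` nearest to `ξ`. -/
abbrev clip (ξ : ℝ) : unitInterval := Set.projIcc 0 1 zero_le_one ξ

theorem coe_clip {ξ : ℝ} (hξ : ξ ∈ Set.Icc (0 : ℝ) 1) : (clip ξ : ℝ) = ξ := by
  rw [clip, Set.projIcc_of_mem zero_le_one hξ]

theorem continuous_clip : Continuous clip := continuous_projIcc

theorem integral_clip (g : ℝ → ℝ) (y z : unitInterval) :
    ∫ ξ in (y : ℝ)..z, g (clip ξ) = ∫ ξ in (y : ℝ)..z, g ξ := by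
  refine intervalIntegral.integral_congr (fun ξ hξ => ?_)
  simp only [coe_clip (uIcc_subset y z hξ)]

theorem continuous_parametric_integral {Y : Type*} [TopologicalSpace Y] {g : Y × ℝ → ℝ}
    (hg : Continuous g) (y : ℝ) : Continuous (fun p : Y × ℝ => ∫ ξ in y..p.2, g (p.1, ξ)) :=
  intervalIntegral.continuous_parametric_intervalIntegral_of_continuous
    (f := fun (p : Y × ℝ) ξ => g (p.1, ξ))
    (hg.comp ((continuous_fst.comp continuous_fst).prodMk continuous_snd)) continuous_snd

theorem CPer.ext_ev {u v : CPer n} (h : ∀ (x : unitInterval) (t : ℝ) (j : Fin n),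
    ev u x t j = ev v x t j) : u = v := by
  ext ⟨x, θ⟩ j
  induction θ using QuotientAddGroup.induction_on with
  | H t =>
    have := h x t j
    rwa [ev_coe, ev_coe] at this

theorem abs_ev_le (u : CPer n) (x t : ℝ) (j : Fin n) : |ev u x t j| ≤ ‖u‖ :=
  (norm_le_pi_norm (ev u x t) j).trans (u.norm_coe_le_norm _)

/-- The operator `u ↦ (∑_{k ≠ j} b_jk u_k)_j`. -/
def couplingOp (b : Fin n → Fin n → C(Strip, ℝ)) : CPer n →L[ℝ] CPer n :=
  LinearMap.mkContinuousOfExistsBound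
    { toFun := fun u => ⟨fun p j => ∑ k ∈ Finset.univ.filter (fun k => k ≠ j), b j k p * u p k, by
        fun_prop⟩
      map_add' := by
        intro u v
        ext p j
        simp [mul_add, Finset.sum_add_distrib]
      map_smul' := by
        intro r u
        ext p j
        simp [Finset.mul_sum, mul_left_comm] }
    (by
      refine ⟨∑ j, ∑ k, ‖b j k‖, fun u => ?_⟩
      refine (ContinuousMap.norm_le _ (by positivity)).mpr (fun p => ?_)
      refine (pi_norm_le_iff_of_nonneg (by positivity)).mpr (fun j => ?_)
      change ‖∑ k ∈ Finset.univ.filter (fun k => k ≠ j), b j k p * u p k‖ ≤ _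
      calc ‖∑ k ∈ Finset.univ.filter (fun k => k ≠ j), b j k p * u p k‖
          ≤ ∑ k ∈ Finset.univ.filter (fun k => k ≠ j), ‖b j k p * u p k‖ := norm_sum_le _ _
        _ ≤ ∑ k, ‖b j k p * u p k‖ :=
          Finset.sum_le_sum_of_subset_of_nonneg (Finset.filter_subset _ _)
            (fun _ _ _ => norm_nonneg _)
        _ ≤ ∑ k, ‖b j k‖ * ‖u‖ := Finset.sum_le_sum (fun k _ => by
          rw [norm_mul]
          exact mul_le_mul ((b j k).norm_coe_le_norm p)
            ((norm_le_pi_norm (u p) k).trans (u.norm_coe_le_norm p)) (norm_nonneg _)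
            (norm_nonneg _))
        _ = (∑ k, ‖b j k‖) * ‖u‖ := (Finset.sum_mul _ _ _).symm
        _ ≤ _ := mul_le_mul_of_nonneg_right
          (Finset.single_le_sum (f := fun j => ∑ k, ‖b j k‖)
            (fun j _ => Finset.sum_nonneg fun k _ => norm_nonneg _) (Finset.mem_univ j))
          (norm_nonneg u))

theorem ev_couplingOp (b : Fin n → Fin n → C(Strip, ℝ)) (u : CPer n) (x t : ℝ) (j : Fin n) :
    ev (couplingOp b u) x t j =
      ∑ k ∈ Finset.univ.filter (fun k => k ≠ j), ev (b j k) x t * ev u x t k := rfl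

section Coefficients

variable {a : Fin n → C(Strip, ℝ)} (ha : ∀ j, IsC1 (a j)) (ha0 : ∀ j p, a j p ≠ 0)
  (b : Fin n → Fin n → C(Strip, ℝ))

include ha ha0

theorem continuous_dCoef (j : Fin n) :
    Continuous (fun p : (unitInterval × ℝ) × ℝ => dCoef a b j (clip p.2) p.1.1 p.1.2) := by
  have h1 : Continuous (fun p : (unitInterval × ℝ) × ℝ => cCoef a b j (clip p.2) p.1.1 p.1.2) :=
    (continuous_cCoef ha ha0 b j).comp
      (continuous_fst.prodMk (continuous_clip.comp continuous_snd))
  refine h1.div ?_ (fun p => ha0 j _)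
  exact (continuous_ev (a j)).comp ((continuous_subtype_val.comp
    (continuous_clip.comp continuous_snd)).prodMk (continuous_omega ha ha0 j))

theorem dCoef_add_period (j : Fin n) (ξ x : unitInterval) (t : ℝ) :
    dCoef a b j ξ x (t + 2 * Real.pi) = dCoef a b j ξ x t := by
  unfold dCoef
  rw [cCoef_add_period ha ha0, omega_add_period ha ha0 j ξ.2, ev_add_period]

theorem omega_omega (j : Fin n) (x y : unitInterval) (t : ℝ) {η : ℝ}
    (hη : η ∈ Set.Icc (0 : ℝ) 1) : omega a j η y (omega a j y x t) = omega a j η x t :=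
  characteristic_characteristic (ha j) (ha0 j) x y t hη

theorem intervalIntegrable_cCoef (j : Fin n) (x y z : unitInterval) (t : ℝ) :
    IntervalIntegrable (fun η => ev (b j j) η (omega a j η x t) / ev (a j) η (omega a j η x t))
      MeasureTheory.volume y z :=
  (((continuousOn_ev_omega ha ha0 j x t (b j j)).div (continuousOn_ev_omega ha ha0 j x t (a j))
    (fun _ _ => ha0 j _)).mono (uIcc_subset y z)).intervalIntegrable

theorem cCoef_mul_cCoef (j : Fin n) (ξ x y : unitInterval) (t : ℝ) :
    cCoef a b j y x t * cCoef a b j ξ y (omega a j y x t) = cCoef a b j ξ x t := by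
  unfold cCoef
  have h1 : ∫ η in (y : ℝ)..ξ, ev (b j j) η (omega a j η y (omega a j y x t)) /
        ev (a j) η (omega a j η y (omega a j y x t)) =
      ∫ η in (y : ℝ)..ξ, ev (b j j) η (omega a j η x t) / ev (a j) η (omega a j η x t) := by
    refine intervalIntegral.integral_congr (fun η hη => ?_)
    simp only [omega_omega ha ha0 j x y t (uIcc_subset y ξ hη)]
  rw [h1, ← Real.exp_add, intervalIntegral.integral_add_adjacent_intervals
    (intervalIntegrable_cCoef ha ha0 b j x x y t) (intervalIntegrable_cCoef ha ha0 b j x y ξ t)]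

theorem cCoef_mul_dCoef (j : Fin n) (ξ x y : unitInterval) (t : ℝ) :
    cCoef a b j y x t * dCoef a b j ξ y (omega a j y x t) = dCoef a b j ξ x t := by
  unfold dCoef
  rw [mul_div_assoc', cCoef_mul_cCoef ha ha0, omega_omega ha ha0 j x y t ξ.2]

omit ha in
theorem exists_dCoef_bound : ∃ D : ℝ, 0 ≤ D ∧ ∀ (j : Fin n) (ξ x : unitInterval) (t : ℝ),
    |dCoef a b j ξ x t| ≤ D := by
  let q : Fin n → C(Strip, ℝ) := fun j =>
    ⟨fun p => b j j p / a j p, (b j j).continuous.div (a j).continuous (ha0 j)⟩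
  choose N hN using fun j => exists_bound (ha0 j)
  have hj : ∀ (j : Fin n) (ξ x : unitInterval) (t : ℝ),
      |dCoef a b j ξ x t| ≤ Real.exp ‖q j‖ * N j := by
    intro j ξ x t
    unfold dCoef
    rw [div_eq_mul_one_div, abs_mul]
    refine mul_le_mul ?_ (hN j _ _) (abs_nonneg _) (Real.exp_pos _).le
    unfold cCoef
    rw [abs_of_pos (Real.exp_pos _), Real.exp_le_exp]
    have h1 : ‖∫ η in (x : ℝ)..ξ, ev (b j j) η (omega a j η x t) /
        ev (a j) η (omega a j η x t)‖ ≤ ‖q j‖ * |(ξ : ℝ) - x| :=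
      intervalIntegral.norm_integral_le_of_norm_le_const
        (fun η _ => (q j).norm_coe_le_norm (clip η, (omega a j η x t : Circ)))
    refine (le_abs_self _).trans (h1.trans (mul_le_of_le_one_right (norm_nonneg _) ?_))
    rw [abs_le]
    constructor <;> linarith [ξ.2.1, ξ.2.2, x.2.1, x.2.2]
  refine ⟨∑ j, Real.exp ‖q j‖ * N j, by positivity, fun j ξ x t => (hj j ξ x t).trans ?_⟩
  exact Finset.single_le_sum (f := fun j => Real.exp ‖q j‖ * (N j : ℝ))
    (fun j _ => by positivity) (Finset.mem_univ j)

theorem hasDerivAt_omega (j : Fin n) (x : unitInterval) (t : ℝ) {ξ : ℝ}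
    (hξ : ξ ∈ Set.Ioo (0 : ℝ) 1) :
    HasDerivAt (fun ξ => omega a j (clip ξ) x t)
      (1 / ev (a j) ξ (omega a j (clip ξ) x t)) ξ := by
  have h1 := ((characteristic_spec (ha j) (ha0 j) x t).2 ξ
    (Set.Ioo_subset_Icc_self hξ)).hasDerivAt (Icc_mem_nhds hξ.1 hξ.2)
  rw [coe_clip (Set.Ioo_subset_Icc_self hξ)]
  refine h1.congr_of_eventuallyEq ?_
  filter_upwards [Icc_mem_nhds hξ.1 hξ.2] with η hη
  rw [coe_clip hη]
  rfl

end Coefficients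

/-- The integrals `∫_{x_j}^x d_j(ξ,x,t) f_j(ξ, ω_j(ξ)) dξ` of a right-hand side along the
characteristics. -/
def sourceFun (m : ℕ) (a : Fin n → C(Strip, ℝ)) (b : Fin n → Fin n → C(Strip, ℝ))
    (f : CPer n) (x : unitInterval) (t : ℝ) : Fin n → ℝ :=
  fun j => ∫ ξ in (bdPoint m j : ℝ)..x, dCoef a b j ξ x t * ev f ξ (omega a j ξ x t) j

section SourceOp

variable (m : ℕ) {a : Fin n → C(Strip, ℝ)} (ha : ∀ j, IsC1 (a j)) (ha0 : ∀ j p, a j p ≠ 0)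
  (b : Fin n → Fin n → C(Strip, ℝ))

include ha ha0

theorem continuous_source_integrand (f : CPer n) (j : Fin n) :
    Continuous (fun p : (unitInterval × ℝ) × ℝ => dCoef a b j (clip p.2) p.1.1 p.1.2 *
      ev f (clip p.2) (omega a j (clip p.2) p.1.1 p.1.2) j) :=
  (continuous_dCoef ha ha0 b j).mul ((continuous_apply j).comp ((continuous_ev f).comp
    ((continuous_subtype_val.comp (continuous_clip.comp continuous_snd)).prodMk
      (continuous_omega ha ha0 j))))

theorem continuous_sourceFun (f : CPer n) :
    Continuous (fun p : unitInterval × ℝ => sourceFun m a b f p.1 p.2) := by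
  refine continuous_pi (fun j => ?_)
  have h1 := (continuous_parametric_integral
    (continuous_source_integrand ha ha0 b f j) (bdPoint m j)).comp
    (f := fun p : unitInterval × ℝ => (p, (p.1 : ℝ))) (by fun_prop)
  refine h1.congr (fun p => ?_)
  exact integral_clip (fun ξ => dCoef a b j ξ p.1 p.2 * ev f ξ (omega a j ξ p.1 p.2) j) _ _

theorem periodic_sourceFun (f : CPer n) (x : unitInterval) :
    Function.Periodic (sourceFun m a b f x) (2 * Real.pi) := by
  intro t
  funext j
  refine intervalIntegral.integral_congr (fun ξ hξ => ?_)
  have hξ' := uIcc_subset _ _ hξ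
  have h1 := dCoef_add_period ha ha0 b j ⟨ξ, hξ'⟩ x t
  simp only at h1
  simp only [h1, omega_add_period ha ha0 j hξ', ev_add_period]

omit ha ha0 in
theorem abs_integral_dCoef_mul_le {D : ℝ} (hD0 : 0 ≤ D)
    (hD : ∀ (j : Fin n) (ξ x : unitInterval) (t : ℝ), |dCoef a b j ξ x t| ≤ D)
    (f : CPer n) (j : Fin n) (x y z : unitInterval) (t : ℝ) :
    |∫ ξ in (y : ℝ)..z, dCoef a b j ξ x t * ev f ξ (omega a j ξ x t) j| ≤
      D * ‖f‖ * |(z : ℝ) - y| := by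
  rw [← Real.norm_eq_abs]
  refine intervalIntegral.norm_integral_le_of_norm_le_const (fun ξ hξ => ?_)
  rw [norm_mul]
  exact mul_le_mul (hD j ⟨ξ, uIcc_subset _ _ (Set.uIoc_subset_uIcc hξ)⟩ x t) (abs_ev_le f _ _ j)
    (norm_nonneg _) hD0

/-- The operator `f ↦ (∫_{x_j}^x d_j f_j)_j`. -/
def sourceOp : CPer n →L[ℝ] CPer n :=
  LinearMap.mkContinuousOfExistsBound
    { toFun := fun f => ofPeriodic (sourceFun m a b f) (periodic_sourceFun m ha ha0 b f)
        (continuous_sourceFun m ha ha0 b f)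
      map_add' := by
        intro f g
        ext ⟨x, θ⟩ j
        induction θ using QuotientAddGroup.induction_on with
        | H t =>
          have hev : ∀ (ξ s : ℝ), ev (f + g) ξ s j = ev f ξ s j + ev g ξ s j := fun _ _ => rfl
          simp only [ContinuousMap.add_apply, Pi.add_apply, ofPeriodic_apply, sourceFun, hev,
            mul_add]
          exact intervalIntegral.integral_add (intervalIntegrable_source ha ha0 b j x _ t f)
            (intervalIntegrable_source ha ha0 b j x _ t g)
      map_smul' := by
        intro r f
        ext ⟨x, θ⟩ j
        induction θ using QuotientAddGroup.induction_on with
        | H t =>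
          have hev : ∀ (ξ s : ℝ), ev (r • f) ξ s j = r * ev f ξ s j := fun _ _ => rfl
          simp only [ContinuousMap.smul_apply, Pi.smul_apply, ofPeriodic_apply, sourceFun, hev,
            mul_left_comm _ r, intervalIntegral.integral_const_mul, smul_eq_mul, RingHom.id_apply] }
    (by
      obtain ⟨D, hD0, hD⟩ := exists_dCoef_bound ha0 b
      refine ⟨D, fun f => ?_⟩
      refine (ContinuousMap.norm_le _ (by positivity)).mpr ?_
      rintro ⟨x, θ⟩
      refine (pi_norm_le_iff_of_nonneg (by positivity)).mpr (fun j => ?_)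
      induction θ using QuotientAddGroup.induction_on with
      | H t =>
        refine (abs_integral_dCoef_mul_le b hD0 hD f j x (bdPoint m j) x t).trans ?_
        refine mul_le_of_le_one_right (by positivity) ?_
        rw [abs_le]
        constructor <;> linarith [(bdPoint m j).2.1, (bdPoint m j).2.2, x.2.1, x.2.2])

theorem ev_sourceOp (f : CPer n) (x : unitInterval) (t : ℝ) (j : Fin n) :
    ev (sourceOp m ha ha0 b f) x t j =
      ∫ ξ in (bdPoint m j : ℝ)..x, dCoef a b j ξ x t * ev f ξ (omega a j ξ x t) j := by
  rw [ev_coe]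
  rfl

theorem isContinuousSolution_iff (R : CPer n →L[ℝ] CPerTime n) (f u : CPer n) :
    IsContinuousSolution m a b R f u ↔
      (1 - boundaryOp m ha ha0 b R + sourceOp m ha ha0 b * couplingOp b : CPer n →L[ℝ] CPer n) u =
        sourceOp m ha ha0 b f := by
  have hev : ∀ (x : unitInterval) (t : ℝ) (j : Fin n),
      ev ((1 - boundaryOp m ha ha0 b R + sourceOp m ha ha0 b * couplingOp b :
        CPer n →L[ℝ] CPer n) u) x t j = ev u x t j -
          cCoef a b j (bdPoint m j) x t * R u (omega a j (bdPoint m j) x t : Circ) j +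
          ∫ ξ in (bdPoint m j : ℝ)..x, dCoef a b j ξ x t *
          ∑ k ∈ Finset.univ.filter (fun k => k ≠ j),
            ev (b j k) ξ (omega a j ξ x t) * ev u ξ (omega a j ξ x t) k := by
    intro x t j
    rw [← boundaryOp_apply m ha ha0 b R u x t j]
    simp only [← ev_couplingOp]
    rw [← ev_sourceOp m ha ha0 b (couplingOp b u) x t j]
    rfl
  constructor
  · intro h
    refine CPer.ext_ev (fun x t j => ?_)
    rw [hev, ev_sourceOp, h j x t]
    ring
  · intro h j x t
    have h1 := hev x t j
    rw [h, ev_sourceOp] at h1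
    rw [h1]
    ring

end SourceOp

end Operators

section Compactness

variable (m : ℕ) {a : Fin n → C(Strip, ℝ)} (ha : ∀ j, IsC1 (a j)) (ha0 : ∀ j p, a j p ≠ 0)
  (b : Fin n → Fin n → C(Strip, ℝ))

theorem nhds_strip (x : unitInterval) (t : ℝ) :
    𝓝 ((x, (t : Circ)) : Strip) = map (fun q : unitInterval × ℝ => (q.1, (q.2 : Circ))) (𝓝 (x, t)) :=
  ((IsOpenQuotientMap.id.prodMap QuotientAddGroup.isOpenQuotientMap_mk :
    IsOpenQuotientMap (Prod.map id ((↑) : ℝ → Circ) :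
      unitInterval × ℝ → unitInterval × Circ)).map_nhds_eq (x, t)).symm

include ha ha0

/-- A single coupling term `k ≠ j`, integrated along the characteristics of the `j`-th equation,
when `u_k` is a function of the form `c_k h(ξ, ω_k(x_k))`. Since `b_jk` vanishes to the order of
`a_k - a_j`, the composition of the two characteristics can be taken as a variable of
integration. -/
theorem eventually_abs_coupling_integral_sub_le {j k : Fin n} {bt : C(Strip, ℝ)}
    (hbt : b j k = bt * (a k - a j)) {ι : Type*} {u : ι → CPer n} {h : ι → ℝ → ℝ → ℝ}
    (hh : ∀ i, Continuous (Function.uncurry (h i))) {M : ℝ}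
    (hM0 : 0 ≤ M) (hM : ∀ i, ∀ ξ ∈ Set.Icc (0 : ℝ) 1, ∀ τ, |h i ξ τ| ≤ M)
    (hL : ∀ i, ∀ ξ ∈ Set.Icc (0 : ℝ) 1, ∀ η ∈ Set.Icc (0 : ℝ) 1, ∀ τ,
      |h i ξ τ - h i η τ| ≤ M * |ξ - η|)
    (hu : ∀ i (x : unitInterval) (t : ℝ), ev (u i) x t k =
      cCoef a b k (bdPoint m k) x t * h i x (omega a k (bdPoint m k) x t))
    (y z : unitInterval) (p₀ : unitInterval × ℝ) {ε : ℝ} (hε : 0 < ε) :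
    ∀ᶠ p in 𝓝 p₀, ∀ i,
      |(∫ ξ in (y : ℝ)..z, dCoef a b j ξ p.1 p.2 * (ev (b j k) ξ (omega a j ξ p.1 p.2) *
          ev (u i) ξ (omega a j ξ p.1 p.2) k)) -
        ∫ ξ in (y : ℝ)..z, dCoef a b j ξ p₀.1 p₀.2 * (ev (b j k) ξ (omega a j ξ p₀.1 p₀.2) *
          ev (u i) ξ (omega a j ξ p₀.1 p₀.2) k)| ≤ ε := by
  obtain ⟨b', hb'⟩ := exists_hasDerivAt_omega_comp ha ha0
  let W : ℝ → unitInterval × ℝ → ℝ := fun ξ p => omega a j (clip ξ) p.1 p.2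
  have hW : Continuous (Function.uncurry W) := (continuous_omega ha ha0 j).comp continuous_swap
  have hcl : Continuous (fun q : ℝ × (unitInterval × ℝ) => clip q.1) :=
    continuous_clip.comp continuous_fst
  have hev : ∀ f : C(Strip, ℝ),
      Continuous (Function.uncurry fun ξ p => ev f (clip ξ) (W ξ p)) := fun f =>
    (continuous_ev f).comp ((continuous_subtype_val.comp hcl).prodMk hW)
  have hcc : ∀ b : Fin n → Fin n → C(Strip, ℝ), Continuous
      (Function.uncurry fun ξ p => cCoef a b k (bdPoint m k) (clip ξ) (W ξ p)) := fun b =>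
    (continuous_cCoef ha ha0 b k).comp ((hcl.prodMk hW).prodMk continuous_const)
  let ψ : ℝ → unitInterval × ℝ → ℝ := fun ξ p => omega a k (bdPoint m k) (clip ξ) (W ξ p)
  have hψ : Continuous (Function.uncurry ψ) := by
    have h1 := (continuous_omega ha ha0 k).comp
      ((hcl.prodMk hW).prodMk (continuous_const (y := (bdPoint m k : ℝ))))
    simp only [Function.comp_def, Set.projIcc_val] at h1
    exact h1
  let ψ' : ℝ → unitInterval × ℝ → ℝ := fun ξ p =>
    (1 / ev (a j) (clip ξ) (W ξ p) - 1 / ev (a k) (clip ξ) (W ξ p)) *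
      cCoef a b' k (bdPoint m k) (clip ξ) (W ξ p)
  have hψ' : Continuous (Function.uncurry ψ') :=
    ((continuous_const.div (hev (a j)) fun _ => ha0 j _).sub
      (continuous_const.div (hev (a k)) fun _ => ha0 k _)).mul (hcc b')
  let G : ℝ → unitInterval × ℝ → ℝ := fun ξ p =>
    dCoef a b j (clip ξ) p.1 p.2 * ev bt (clip ξ) (W ξ p) * ev (a j) (clip ξ) (W ξ p) *
      ev (a k) (clip ξ) (W ξ p) * cCoef a b k (bdPoint m k) (clip ξ) (W ξ p) /
      cCoef a b' k (bdPoint m k) (clip ξ) (W ξ p)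
  have hG : Continuous (Function.uncurry G) :=
    (((((continuous_dCoef ha ha0 b j).comp continuous_swap).mul (hev bt)).mul (hev (a j))).mul
      (hev (a k))).mul (hcc b) |>.div (hcc b') (fun _ => (Real.exp_pos _).ne')
  have hder : ∀ p, ∀ ξ ∈ Set.Ioo (0 : ℝ) 1, HasDerivAt (fun ξ => ψ ξ p) (ψ' ξ p) ξ := by
    intro p ξ hξ
    have h1 := hb' k (bdPoint m k) (fun ξ => W ξ p)
      (hW.comp (continuous_id.prodMk continuous_const)) ξ hξ _ (hasDerivAt_omega ha ha0 j p.1 p.2 hξ)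
    refine h1.congr_deriv ?_
    simp only [ψ', W, coe_clip (Set.Ioo_subset_Icc_self hξ)]
  have hint : ∀ i p, (∫ ξ in (y : ℝ)..z, dCoef a b j ξ p.1 p.2 *
      (ev (b j k) ξ (omega a j ξ p.1 p.2) * ev (u i) ξ (omega a j ξ p.1 p.2) k)) =
      ∫ ξ in (y : ℝ)..z, G ξ p * ψ' ξ p * h i ξ (ψ ξ p) := by
    intro i p
    refine intervalIntegral.integral_congr (fun ξ hξ => ?_)
    have hcξ := coe_clip (uIcc_subset y z hξ)
    have h1 := hu i (clip ξ) (W ξ p)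
    have h2 : ev (b j k) (clip ξ) (W ξ p) = ev bt (clip ξ) (W ξ p) *
        (ev (a k) (clip ξ) (W ξ p) - ev (a j) (clip ξ) (W ξ p)) := by rw [hbt]; rfl
    have h3 : ev (a j) (clip ξ) (W ξ p) ≠ 0 := ha0 j _
    have h4 : ev (a k) (clip ξ) (W ξ p) ≠ 0 := ha0 k _
    have h5 : cCoef a b' k (bdPoint m k) (clip ξ) (W ξ p) ≠ 0 := (Real.exp_pos _).ne'
    have h6 : dCoef a b j ξ p.1 p.2 * (ev (b j k) ξ (omega a j ξ p.1 p.2) *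
        ev (u i) ξ (omega a j ξ p.1 p.2) k) =
        dCoef a b j (clip ξ) p.1 p.2 * (ev (b j k) (clip ξ) (W ξ p) *
          ev (u i) (clip ξ) (W ξ p) k) := by simp only [W, hcξ]
    rw [h6, h1, h2]
    simp only [G, ψ', ψ]
    rw [hcξ] at h3 h4 ⊢
    field_simp
  simp only [hint]
  exact eventually_abs_integral_sub_le hG hψ hψ' hder hh hM0 hM hL y.2 z.2 p₀ hε

/-- The coupling terms of functions of the form `c_k h(x, ω_k(x_k))`, integrated along the
characteristics, depend compactly on these functions. -/
theorem isCompactOperator_sourceOp_couplingOp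
    (hab : ∀ j k, j ≠ k → ∃ bt : C(Strip, ℝ), IsC1 bt ∧ b j k = bt * (a k - a j))
    (E : CPer n →L[ℝ] CPer n) {h : CPer n → Fin n → ℝ → ℝ → ℝ}
    (hh : ∀ v k, Continuous (Function.uncurry (h v k))) {M : ℝ} (hM0 : 0 ≤ M)
    (hM : ∀ v, ‖v‖ ≤ 1 → ∀ k, ∀ ξ ∈ Set.Icc (0 : ℝ) 1, ∀ τ, |h v k ξ τ| ≤ M)
    (hL : ∀ v, ‖v‖ ≤ 1 → ∀ k, ∀ ξ ∈ Set.Icc (0 : ℝ) 1, ∀ η ∈ Set.Icc (0 : ℝ) 1, ∀ τ,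
      |h v k ξ τ - h v k η τ| ≤ M * |ξ - η|)
    (hE : ∀ v k (x : unitInterval) (t : ℝ), ev (E v) x t k =
      cCoef a b k (bdPoint m k) x t * h v k x (omega a k (bdPoint m k) x t)) :
    IsCompactOperator
      (sourceOp m ha ha0 b * couplingOp b * E : CPer n →L[ℝ] CPer n) := by
  refine isCompactOperator_of_equicontinuousAt _ ?_
  rintro ⟨x₀, θ⟩ ε hε
  induction θ using QuotientAddGroup.induction_on with
  | H t₀ =>
  change ∀ᶠ p in 𝓝 ((x₀, (t₀ : Circ)) : Strip), _
  rw [nhds_strip, eventually_map]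
  obtain ⟨D, hD0, hD⟩ := exists_dCoef_bound ha0 b
  set S : CPer n →L[ℝ] CPer n := couplingOp b * E with hS
  let I : Fin n → CPer n → unitInterval → unitInterval × ℝ → ℝ := fun j v z p =>
    ∫ ξ in (bdPoint m j : ℝ)..z, dCoef a b j ξ p.1 p.2 * ev (S v) ξ (omega a j ξ p.1 p.2) j
  have hval : ∀ v (p : unitInterval × ℝ) (j : Fin n),
      (sourceOp m ha ha0 b * couplingOp b * E : CPer n →L[ℝ] CPer n) v (p.1, (p.2 : Circ)) j =
        I j v p.1 p := by
    intro v p j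
    rw [← ev_coe]
    exact ev_sourceOp m ha ha0 b (S v) p.1 p.2 j
  have hfirst : ∀ᶠ p : unitInterval × ℝ in 𝓝 (x₀, t₀), ∀ (j : Fin n) (v : CPer n), ‖v‖ ≤ 1 →
      |I j v p.1 p - I j v x₀ p| ≤ ε / 2 := by
    have hc : Continuous (fun p : unitInterval × ℝ => D * ‖S‖ * |(p.1 : ℝ) - x₀|) := by fun_prop
    filter_upwards [(hc.continuousAt (x := (x₀, t₀))).eventually_lt
      (continuousAt_const (y := ε / 2)) (by simpa using half_pos hε)] with p hp j v hv
    have h1 : I j v p.1 p - I j v x₀ p =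
        ∫ ξ in (x₀ : ℝ)..p.1, dCoef a b j ξ p.1 p.2 * ev (S v) ξ (omega a j ξ p.1 p.2) j :=
      intervalIntegral.integral_interval_sub_left
        (((continuousOn_dCoef ha ha0 b j p.1 p.2).mul ((continuous_apply j).comp_continuousOn
          (continuousOn_ev_omega ha ha0 j p.1 p.2 (S v)))).mono (uIcc_subset _ _)).intervalIntegrable
        (((continuousOn_dCoef ha ha0 b j p.1 p.2).mul ((continuous_apply j).comp_continuousOn
          (continuousOn_ev_omega ha ha0 j p.1 p.2 (S v)))).mono (uIcc_subset _ _)).intervalIntegrable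
    rw [h1]
    refine (abs_integral_dCoef_mul_le b hD0 hD (S v) j p.1 x₀ p.1 p.2).trans ?_
    refine (mul_le_mul_of_nonneg_right (mul_le_mul_of_nonneg_left ?_ hD0)
      (abs_nonneg _)).trans hp.le
    exact (S.le_opNorm v).trans (mul_le_of_le_one_right (norm_nonneg _) hv)
  have hsecond : ∀ j, ∀ᶠ p : unitInterval × ℝ in 𝓝 (x₀, t₀), ∀ v : CPer n, ‖v‖ ≤ 1 →
      |I j v x₀ p - I j v x₀ (x₀, t₀)| ≤ ε / 2 := by
    intro j
    let J : Fin n → CPer n → unitInterval × ℝ → ℝ := fun k v p =>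
      ∫ ξ in (bdPoint m j : ℝ)..x₀, dCoef a b j ξ p.1 p.2 *
        (ev (b j k) ξ (omega a j ξ p.1 p.2) * ev (E v) ξ (omega a j ξ p.1 p.2) k)
    have hIJ : ∀ v p, I j v x₀ p = ∑ k ∈ Finset.univ.filter (fun k => k ≠ j), J k v p := by
      intro v p
      have h1 : ∀ ξ, dCoef a b j ξ p.1 p.2 * ev (S v) ξ (omega a j ξ p.1 p.2) j =
          ∑ k ∈ Finset.univ.filter (fun k => k ≠ j), dCoef a b j ξ p.1 p.2 *
            (ev (b j k) ξ (omega a j ξ p.1 p.2) * ev (E v) ξ (omega a j ξ p.1 p.2) k) := by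
        intro ξ
        rw [← Finset.mul_sum]
        rfl
      simp only [I, J, h1]
      refine intervalIntegral.integral_finsetSum (fun k _ => ?_)
      refine (ContinuousOn.mono ?_ (uIcc_subset _ _)).intervalIntegrable
      exact (continuousOn_dCoef ha ha0 b j p.1 p.2).mul
        ((continuousOn_ev_omega ha ha0 j p.1 p.2 (b j k)).mul
          ((continuous_apply k).comp_continuousOn (continuousOn_ev_omega ha ha0 j p.1 p.2 (E v))))
    have hδ : 0 < ε / 2 / (n + 1) := by positivity
    have hJ : ∀ᶠ p : unitInterval × ℝ in 𝓝 (x₀, t₀),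
        ∀ k ∈ Finset.univ.filter (fun k => k ≠ j), ∀ v : {v : CPer n // ‖v‖ ≤ 1},
        |J k v p - J k v (x₀, t₀)| ≤ ε / 2 / (n + 1) := by
      rw [Filter.eventually_all_finset]
      intro k hk
      obtain ⟨bt, -, hbt⟩ := hab j k (Finset.mem_filter.mp hk).2.symm
      exact eventually_abs_coupling_integral_sub_le m ha ha0 b hbt
        (u := fun v : {v : CPer n // ‖v‖ ≤ 1} => E v) (fun v => hh v k) hM0
        (fun v => hM v v.2 k) (fun v => hL v v.2 k) (fun v => hE v k) _ x₀ (x₀, t₀) hδ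
    filter_upwards [hJ] with p hp v hv
    rw [hIJ, hIJ, ← Finset.sum_sub_distrib]
    refine (Finset.abs_sum_le_sum_abs _ _).trans
      ((Finset.sum_le_sum fun k hk => hp k hk ⟨v, hv⟩).trans ?_)
    rw [Finset.sum_const, nsmul_eq_mul]
    have hcard : ((Finset.univ.filter (fun k => k ≠ j)).card : ℝ) ≤ n + 1 := by
      have := Finset.card_filter_le (Finset.univ : Finset (Fin n)) (fun k => k ≠ j)
      rw [Finset.card_univ, Fintype.card_fin] at this
      have h2 : ((Finset.univ.filter (fun k => k ≠ j)).card : ℝ) ≤ n := by exact_mod_cast this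
      linarith
    calc _ ≤ ((n : ℝ) + 1) * (ε / 2 / (n + 1)) := mul_le_mul_of_nonneg_right hcard hδ.le
      _ = ε / 2 := by field_simp
  filter_upwards [hfirst, eventually_all.mpr hsecond] with p hp1 hp2 v hv
  refine (pi_norm_le_iff_of_nonneg hε.le).mpr (fun j => ?_)
  rw [Pi.sub_apply, Real.norm_eq_abs]
  have e1 := hval v p j
  have e2 := hval v (x₀, t₀) j
  refine (abs_sub_le _ (I j v x₀ p) _).trans ?_
  refine (add_le_add (le_of_eq_of_le ?_ (hp1 j v hv)) (le_of_eq_of_le ?_ (hp2 j v hv))).trans_eq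
    (add_halves ε)
  · rw [e1]
  · exact congrArg (fun r => |I j v x₀ p - r|) e2

theorem isCompactOperator_sourceOp_couplingOp_boundaryOp (R : CPer n →L[ℝ] CPerTime n)
    (hab : ∀ j k, j ≠ k → ∃ bt : C(Strip, ℝ), IsC1 bt ∧ b j k = bt * (a k - a j)) :
    IsCompactOperator (sourceOp m ha ha0 b * couplingOp b * boundaryOp m ha ha0 b R :
      CPer n →L[ℝ] CPer n) := by
  refine isCompactOperator_sourceOp_couplingOp m ha ha0 b hab _
    (h := fun v k _ τ => R v (τ : Circ) k) (fun v k => ?_) (norm_nonneg R)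
    (fun v hv k ξ _ τ => ?_) (fun v _ k ξ _ η _ τ => ?_)
    (fun v k x t => boundaryOp_apply m ha ha0 b R v x t k)
  · exact (continuous_apply k).comp ((R v).continuous.comp
      ((AddCircle.continuous_mk' _).comp continuous_snd))
  · exact ((norm_le_pi_norm _ k).trans ((R v).norm_coe_le_norm _)).trans
      ((R.le_opNorm v).trans (mul_le_of_le_one_right (norm_nonneg _) hv))
  · rw [sub_self, abs_zero]
    positivity

theorem isCompactOperator_sourceOp_couplingOp_sourceOp
    (hab : ∀ j k, j ≠ k → ∃ bt : C(Strip, ℝ), IsC1 bt ∧ b j k = bt * (a k - a j)) :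
    IsCompactOperator (sourceOp m ha ha0 b * couplingOp b * sourceOp m ha ha0 b :
      CPer n →L[ℝ] CPer n) := by
  obtain ⟨D, hD0, hD⟩ := exists_dCoef_bound ha0 b
  let g : CPer n → Fin n → ℝ × ℝ → ℝ := fun v k q =>
    dCoef a b k (clip q.2) (bdPoint m k) q.1 *
      ev v (clip q.2) (omega a k (clip q.2) (bdPoint m k) q.1) k
  have hg : ∀ v k, Continuous (g v k) := fun v k =>
    (continuous_source_integrand ha ha0 b v k).comp
      (f := fun q : ℝ × ℝ => ((bdPoint m k, q.1), q.2)) (by fun_prop)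
  have hgb : ∀ v, ‖v‖ ≤ 1 → ∀ k q, |g v k q| ≤ D := by
    intro v hv k q
    rw [abs_mul]
    exact (mul_le_mul (hD k _ _ _) ((abs_ev_le v _ _ k).trans hv) (abs_nonneg _) hD0).trans_eq
      (mul_one D)
  have hgi : ∀ v, ‖v‖ ≤ 1 → ∀ k τ (y z : ℝ), |∫ ξ in y..z, g v k (τ, ξ)| ≤ D * |z - y| :=
    fun v hv k τ y z => intervalIntegral.norm_integral_le_of_norm_le_const
      (f := fun ξ => g v k (τ, ξ)) fun ξ _ => hgb v hv k (τ, ξ)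
  refine isCompactOperator_sourceOp_couplingOp m ha ha0 b hab _
    (h := fun v k ξ τ => ∫ η in (bdPoint m k : ℝ)..ξ, g v k (τ, η)) (fun v k => ?_) hD0
    (fun v hv k ξ hξ τ => ?_) (fun v hv k ξ _ η _ τ => ?_) (fun v k x t => ?_)
  · have hc := continuous_parametric_integral (hg v k) (bdPoint m k : ℝ)
    exact hc.comp (f := fun p : ℝ × ℝ => (p.2, p.1)) (by fun_prop)
  · refine (hgi v hv k τ _ _).trans (mul_le_of_le_one_right hD0 ?_)
    rw [abs_le]
    constructor <;> linarith [(bdPoint m k).2.1, (bdPoint m k).2.2, hξ.1, hξ.2]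
  · have hc : Continuous (fun η => g v k (τ, η)) :=
      (hg v k).comp (continuous_const.prodMk continuous_id)
    rw [intervalIntegral.integral_interval_sub_left (hc.intervalIntegrable _ _)
      (hc.intervalIntegrable _ _)]
    exact hgi v hv k τ _ _
  · rw [ev_sourceOp, ← intervalIntegral.integral_const_mul]
    refine intervalIntegral.integral_congr (fun η hη => ?_)
    have hη' := uIcc_subset _ _ hη
    have h1 := cCoef_mul_dCoef ha ha0 b k ⟨η, hη'⟩ x (bdPoint m k) t
    simp only [g, coe_clip hη', omega_omega ha ha0 k x (bdPoint m k) t hη'] at h1 ⊢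
    rw [← mul_assoc, h1]

end Compactness

end Hyperbolic

end

open Hyperbolic in
/-- Fredholm alternative for continuous time-periodic solutions of first-order hyperbolic systems
with general boundary operators. -/
theorem theorem1p1 (n m : ℕ) (hm : m ≤ n)
    (a : Fin n → C(Strip, ℝ)) (b : Fin n → Fin n → C(Strip, ℝ))
    (R : CPer n →L[ℝ] CPerTime n)
    (ha : ∀ j, IsC1 (a j)) (hb : ∀ j k, IsC1 (b j k))
    (ha0 : ∀ j p, a j p ≠ 0)
    (hab : ∀ j k, j ≠ k → ∃ bt : C(Strip, ℝ), IsC1 bt ∧ b j k = bt * (a k - a j))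
    (hR : IsC1Bounded R)
    (hC : ∃ ℓ : ℕ, ‖(boundaryOp m ha ha0 b R) ^ ℓ‖ < 1) :
    (FiniteDimensional ℝ (solutionKernel m ha ha0 b R) ∧
      IsClosed (solvableSpace m ha ha0 b R : Set (CPer n)) ∧
      FiniteDimensional ℝ (CPer n ⧸ solvableSpace m ha ha0 b R) ∧
      Module.finrank ℝ (CPer n ⧸ solvableSpace m ha ha0 b R) =
        Module.finrank ℝ (solutionKernel m ha ha0 b R)) ∧
    (Module.finrank ℝ (solutionKernel m ha ha0 b R) = 0 →
      ∀ f : CPer n, ∃! u : CPer n, IsContinuousSolution m a b R f u) := by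
  obtain ⟨hfin, G, hG, hGfin, hGrank⟩ := fredholm_alternative hC
    (isCompactOperator_sourceOp_couplingOp_boundaryOp m ha ha0 b R hab)
    (isCompactOperator_sourceOp_couplingOp_sourceOp m ha ha0 b hab)
  set L : CPer n →L[ℝ] CPer n :=
    1 - boundaryOp m ha ha0 b R + sourceOp m ha ha0 b * couplingOp b with hL
  have hsol : ∀ f u, IsContinuousSolution m a b R f u ↔ L u = sourceOp m ha ha0 b f :=
    isContinuousSolution_iff m ha ha0 b R
  have hker : solutionKernel m ha ha0 b R = L.ker := by
    ext u
    exact (hsol 0 u).trans (by rw [map_zero]; rfl)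
  have hsolv : solvableSpace m ha ha0 b R = G.ker := by
    ext f
    exact (exists_congr fun u => hsol f u).trans (hG f).symm
  have e : (CPer n ⧸ G.ker) ≃ₗ[ℝ] G.range := (G : CPer n →ₗ[ℝ] CPer n).quotKerEquivRange
  have hquot : FiniteDimensional ℝ (CPer n ⧸ G.ker) := e.symm.finiteDimensional
  rw [hker, hsolv]
  refine ⟨⟨hfin, G.isClosed_ker, hquot, e.finrank_eq.trans hGrank⟩, fun h0 f => ?_⟩
  have hbot : L.ker = ⊥ := Submodule.finrank_eq_zero.mp h0
  rw [← hGrank] at h0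
  have hGbot : G.range = ⊥ := Submodule.finrank_eq_zero.mp h0
  have hGf : G f = 0 := by
    have : G f ∈ G.range := ⟨f, rfl⟩
    rwa [hGbot] at this
  obtain ⟨u, hu⟩ := (hG f).mp hGf
  refine ⟨u, (hsol f u).mpr hu, fun w hw => ?_⟩
  have h1 := (hsol f w).mp hw
  exact LinearMap.ker_eq_bot.mp hbot (h1.trans hu.symm)
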